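/- For a random variable $f$ on a probability space $(\Omega,\mathcal A,\mathbb P)$ and $1\le r<\infty$ put $\varphi_r(t)=e^{t^r}-1$ and $$\|f\|_{L_{\varphi_r}}=\inf\Big\{\varepsilon>0:\ \int_\Omega \varphi_r\big(|f|/\varepsilon\big)\,d\mathbb P\le 1\Big\}\in[0,\infty].$$ A complex (in particular, a real) random variable $f$ is subgaussian if there is $s\ge 0$ with $\mathbb E\exp(\mathrm{Re}(zf))\le \exp(s^2|z|^2/2)$ for all $z\in\mathbb C$; the best such $s$ is denoted $\mathrm{sg}(f)$. For $1<p\le\infty$ with conjugate exponent $p'$ let $r(p)=\max\{p',2\}$. Let $B_{\ell_p^n}$ be the closed unit ball of $\ell_p^n=(\mathbb C^n,\|\cdot\|_p)$; multi-indices $\alpha$ range over $\mathbb N_0^n$, $|\alpha|=\alpha_1+\dots+\alpha_n$, and $z^\alpha=z_1^{\alpha_1}\cdots z_n^{\alpha_n}$. (1) Let $1<p\le\infty$ and $s\ge 0$, and, if $r(p)>2$, let also $M\ge 0$. There is a constant $C>0$, depending only on $s$ if $r(p)=2$, and only on $r(p)$, $s$ and $M$ if $r(p)>2$, such that for all integers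 $n,m\ge 1$ and every family $(\gamma_\alpha)_{|\alpha|=m}$ of independent (real or complex) subgaussian random variables on a probability space with $\sup_\alpha \mathrm{sg}(\gamma_\alpha)\le s$ and, if $r(p)>2$, also $\sup_\alpha\|\gamma_\alpha\|_\infty\le M$, we have $$\bigg\|\sup_{z\in B_{\ell_p^n}}\Big|\sum_{|\alpha|=m}\gamma_\alpha z^\alpha\Big|\bigg\|_{L_{\varphi_{r(p)}}}\le C\,\big(n(1+\log m)\big)^{\frac1{r(p)}}\,n^{m\max\{\frac12-\frac1p,0\}}.$$ (2) Let $1<p\le\infty$ and let $m\ge 1$ be an integer. There are constants $c,C>0$, depending only on $m$ and $p$, such that for every integer $n\ge 1$ and every family $(\gamma_\alpha)_{|\alpha|=m}$ of independent random variables on a probability space, each of which is a Rademacher variable (values $\pm1$ with probability $\frac12$), or a Steinhaus variable (uniformly distributed on the unit circle), or, in the case $r(p)=2$ only, a standard real normal variable or a standard complex normal variable (independent centered normal real and imaginary parts of variance $\frac12$), we have $$c\,n^{\frac1{r(p)}+m\max\{\frac12-\frac1p,0\}}\le\bigg\|\sup_{z\in B_{\ell_p^n}}\Big|\sum_{|\alpha|=m}\gamma_\alpha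 z^\alpha\Big|\bigg\|_{L_{\varphi_{r(p)}}}\le C\,n^{\frac1{r(p)}+m\max\{\frac12-\frac1p,0\}}.$$ -/

import Mathlib

open MeasureTheory ProbabilityTheory
open scoped ENNReal NNReal

universe u

noncomputable section

/-! ### Exponential Orlicz norms -/

/-- The exponential Orlicz function `φ_r(t) = exp (t ^ r) - 1`, for `t ≥ 0`. -/
def expOrlicz (r t : ℝ) : ℝ := Real.exp (t ^ r) - 1

/-- The Luxemburg norm `inf {ε > 0 : ∫ φ_r(|f| / ε) dμ ≤ 1}` of `f` in the exponential Orlicz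
space, with value `∞` if there is no such `ε`, that is, if `f` is not in the space. -/
def expOrliczNorm {Ω : Type u} [MeasurableSpace Ω] (r : ℝ) (f : Ω → ℝ) (μ : Measure Ω) : ℝ≥0∞ :=
  ⨅ (ε : ℝ) (_ : 0 < ε) (_ : ∫⁻ ω, ENNReal.ofReal (expOrlicz r (|f ω| / ε)) ∂μ ≤ 1),
    ENNReal.ofReal ε

/-! ### Subgaussian random variables -/

/-- `E exp (Re (z f)) ≤ exp (s² |z|² / 2)` for all complex `z` (with the expectation finite). -/
def HasSubgaussianBound {Ω : Type u} [MeasurableSpace Ω] (f : Ω → ℂ) (μ : Measure Ω) (s : ℝ) :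
    Prop :=
  0 ≤ s ∧ ∀ z : ℂ, Integrable (fun ω => Real.exp (z * f ω).re) μ ∧
    ∫ ω, Real.exp (z * f ω).re ∂μ ≤ Real.exp (s ^ 2 * ‖z‖ ^ 2 / 2)

/-- For a real-valued variable the complex condition is the usual real one, so that real
subgaussian variables are complex subgaussian variables with the same constants. -/
theorem hasSubgaussianBound_ofReal_iff {Ω : Type u} [MeasurableSpace Ω] (f : Ω → ℝ)
    (μ : Measure Ω) (s : ℝ) :
    HasSubgaussianBound (fun ω => (f ω : ℂ)) μ s ↔
      0 ≤ s ∧ ∀ x : ℝ, Integrable (fun ω => Real.exp (x * f ω)) μ ∧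
        ∫ ω, Real.exp (x * f ω) ∂μ ≤ Real.exp (s ^ 2 * x ^ 2 / 2) := by
  refine and_congr_right fun _ => ⟨fun h x => ?_, fun h z => ?_⟩
  · simpa using h x
  · have h1 := h z.re
    have h2 : z.re ^ 2 ≤ ‖z‖ ^ 2 := by
      rw [← sq_abs]
      exact pow_le_pow_left₀ (abs_nonneg _) (Complex.abs_re_le_norm z) 2
    refine ⟨by simpa using h1.1, ?_⟩
    have h3 : ∫ ω, Real.exp (z * (f ω : ℂ)).re ∂μ ≤ Real.exp (s ^ 2 * z.re ^ 2 / 2) := by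
      simpa using h1.2
    refine h3.trans (Real.exp_le_exp.2 ?_)
    have h4 := mul_le_mul_of_nonneg_left h2 (sq_nonneg s)
    linarith

/-- A complex random variable is subgaussian if it has some subgaussian bound. -/
def IsSubgaussian {Ω : Type u} [MeasurableSpace Ω] (f : Ω → ℂ) (μ : Measure Ω) : Prop :=
  ∃ s : ℝ, HasSubgaussianBound f μ s

/-- The best subgaussian constant `sg(f)`. -/
def sg {Ω : Type u} [MeasurableSpace Ω] (f : Ω → ℂ) (μ : Measure Ω) : ℝ :=
  sInf {s : ℝ | HasSubgaussianBound f μ s}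

/-! ### The special distributions -/

/-- The Rademacher distribution: the values `1` and `-1` with probability `1/2` each. -/
def rademacherLaw : Measure ℂ :=
  (2⁻¹ : ℝ≥0∞) • Measure.dirac 1 + (2⁻¹ : ℝ≥0∞) • Measure.dirac (-1)

/-- The Steinhaus distribution: normalized Haar measure on the unit circle, as the image of the
normalized Haar measure of `ℝ / ℤ` under `t ↦ exp (2 π i t)`. -/
def steinhausLaw : Measure ℂ :=
  (AddCircle.haarAddCircle : Measure (AddCircle (1 : ℝ))).map
    (fun t => (AddCircle.toCircle t : ℂ))

/-- The standard real normal distribution, on the real axis of the complex plane. -/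
def realNormalLaw : Measure ℂ :=
  (gaussianReal 0 1).map (fun x : ℝ => (x : ℂ))

/-- The standard complex normal distribution: independent centered normal real and imaginary
parts, each of variance `1/2`. -/
def complexNormalLaw : Measure ℂ :=
  ((gaussianReal 0 (1 / 2)).prod (gaussianReal 0 (1 / 2))).map
    (fun x : ℝ × ℝ => (x.1 : ℂ) + (x.2 : ℂ) * Complex.I)

/-! ### Random homogeneous polynomials -/

/-- Multi-indices `α ∈ ℕ₀ⁿ` with `|α| = m`. -/
abbrev MultiIndex (n m : ℕ) : Type :=
  {α : Fin n → ℕ // α ∈ (Finset.univ : Finset (Fin n)).piAntidiag m}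

/-- The exponent `r(p) = max {p', 2}`, with `p'` the conjugate exponent of `p`
(finite for `1 < p`). -/
def rExp (p : ℝ≥0∞) : ℝ := (max (ENNReal.conjExponent p) 2).toReal

/-- `sup_{z ∈ B} |∑_{|α| = m} c_α z^α|` where `B` is the closed unit ball of complex `ℓ_p^n`. -/
def polySup (p : ℝ≥0∞) {n m : ℕ} (c : MultiIndex n m → ℂ) : ℝ :=
  ⨆ z : {z : PiLp p (fun _ : Fin n => ℂ) // ‖z‖ ≤ 1},
    ‖∑ α : MultiIndex n m, c α * ∏ i, z.1 i ^ α.1 i‖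

end

/-! Upper bounds. For fixed `z` in the ball, `∑ γ_α z^α` is a weighted sum of independent
subgaussian variables. If `p ≥ 2` its variance proxy is `s² ∑ |z^α|² ≤ s² (∑ |z_i|²)^m ≤ s²
n^(2m(1/2 - 1/p))`, so its tails are gaussian (`measure_norm_sum_ge_le`). If `p < 2` the family
`(z^α)` lies in the unit ball of `ℓ_p`. The few large coefficients are controlled by boundedness of
the variables and the small ones by subgaussianity, which gives tails `exp(-c t^r)` with `r = p'`
(`measure_norm_sum_ge_le_of_bounded`). A polynomial of degree `m` varies little at scale `1/m`, so
the supremum is at most twice a maximum over `(25 m)^(2n)` points (`exists_net_polySup_le`). In the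
exponential Orlicz norm such a maximum costs the `r`-th root of the logarithm of the number of
points, hence the factor `(n (1 + log m))^(1/r)`.

Lower bounds. For `r ≥ 1` the Orlicz norm dominates half the mean (`le_expOrliczNorm`). Averaging
over roots of unity isolates the part of the polynomial that is linear in the variables from a set
`B`, and free phases in these variables add up the moduli of its coefficients
(`sum_norm_linear_part_le_polySup`). Each coefficient is a sum of at least `|Bᶜ|^(m-1) / (m-1)!` of
the variables, and its mean modulus is bounded below by a Khinchin inequality
(`exists_le_lintegral_norm_sum`). For `p ≥ 2` one takes `B` to be half of the variables and a flat
vector `z`; for `p < 2`, `B` is all variables but one, and the remaining one carries half of the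
`ℓ_p` mass. -/

noncomputable section

/-! ### Homogeneous polynomials -/

/-- The value of the homogeneous polynomial `∑_{|α| = m} c_α z^α`. -/
def homEval {n m : ℕ} (c : MultiIndex n m → ℂ) (z : Fin n → ℂ) : ℂ :=
  ∑ α : MultiIndex n m, c α * ∏ i, z i ^ α.1 i

theorem MultiIndex.sum_eq {n m : ℕ} (α : MultiIndex n m) : ∑ i, α.1 i = m :=
  (Finset.mem_piAntidiag.1 α.2).1

/-- Multinomial theorem, with every multinomial coefficient at least `1`. It carries `ℓ_2` and `ℓ_p`
bounds from `z` to the family of its monomials. -/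
theorem sum_multiIndex_prod_pow_le {n m : ℕ} {x : Fin n → ℝ} (hx : ∀ i, 0 ≤ x i) :
    ∑ α : MultiIndex n m, ∏ i, x i ^ α.1 i ≤ (∑ i, x i) ^ m := by
  rw [Finset.sum_pow_eq_sum_piAntidiag,
    Finset.sum_coe_sort (Finset.univ.piAntidiag m) (fun α : Fin n → ℕ => ∏ i, x i ^ α i)]
  refine Finset.sum_le_sum fun α _ => ?_
  have h1 : (1 : ℝ) ≤ (Nat.multinomial Finset.univ α : ℝ) := by
    exact_mod_cast Nat.multinomial_pos _ _
  exact le_mul_of_one_le_left (Finset.prod_nonneg fun i _ => pow_nonneg (hx i) _) h1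

/-- Multinomial theorem with all variables `1`, where each coefficient is at most `k!`. -/
theorem pow_card_le_card_piAntidiag {ι : Type*} [DecidableEq ι] (s : Finset ι) (k : ℕ) :
    s.card ^ k ≤ (s.piAntidiag k).card * k.factorial := by
  have h := Finset.sum_pow_eq_sum_piAntidiag s (fun _ => (1 : ℕ)) k
  simp only [Finset.sum_const, smul_eq_mul, mul_one, one_pow, Finset.prod_const_one,
    Nat.cast_id] at h
  rw [h, ← smul_eq_mul]
  refine Finset.sum_le_card_nsmul _ _ _ fun α hα => ?_
  rw [Nat.multinomial, (Finset.mem_piAntidiag.1 hα).1]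
  exact Nat.div_le_self _ _

theorem homEval_smul {n m : ℕ} (c : MultiIndex n m → ℂ) (t : ℂ) (z : Fin n → ℂ) :
    homEval c (fun i => t * z i) = t ^ m * homEval c z := by
  simp only [homEval, Finset.mul_sum]
  refine Finset.sum_congr rfl fun α _ => ?_
  simp only [mul_pow, Finset.prod_mul_distrib, Finset.prod_pow_eq_pow_sum, α.sum_eq]
  ring

theorem continuous_homEval {n m : ℕ} (c : MultiIndex n m → ℂ) : Continuous (homEval c) := by
  unfold homEval
  fun_prop

theorem polySup_eq (p : ℝ≥0∞) {n m : ℕ} (c : MultiIndex n m → ℂ) :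
    polySup p c = ⨆ z : {z : PiLp p (fun _ : Fin n => ℂ) // ‖z‖ ≤ 1}, ‖homEval c z.1.ofLp‖ := rfl

theorem polySup_nonneg (p : ℝ≥0∞) {n m : ℕ} (c : MultiIndex n m → ℂ) : 0 ≤ polySup p c :=
  Real.iSup_nonneg fun _ => norm_nonneg _

section

variable {p : ℝ≥0∞} [Fact (1 ≤ p)] {n m : ℕ}

/-- Compactness of the ball is needed: the real supremum of an unbounded family would be the default
value `0`. -/
theorem norm_homEval_le_polySup (c : MultiIndex n m → ℂ) {z : PiLp p (fun _ : Fin n => ℂ)}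
    (hz : ‖z‖ ≤ 1) : ‖homEval c z.ofLp‖ ≤ polySup p c := by
  rw [polySup_eq]
  refine le_ciSup (f := fun z : {z : PiLp p (fun _ : Fin n => ℂ) // ‖z‖ ≤ 1} =>
    ‖homEval c z.1.ofLp‖) ?_ ⟨z, hz⟩
  have hcont : Continuous fun z : PiLp p (fun _ : Fin n => ℂ) => ‖homEval c z.ofLp‖ :=
    ((continuous_homEval c).comp (PiLp.continuous_ofLp p _)).norm
  have hK := ((isCompact_closedBall (0 : PiLp p (fun _ : Fin n => ℂ)) 1).image hcont).bddAbove
  refine hK.mono ?_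
  rintro _ ⟨y, rfl⟩
  exact ⟨y.1, by simpa using y.2, rfl⟩

theorem norm_homEval_le (c : MultiIndex n m → ℂ) (hm : m ≠ 0) (z : PiLp p (fun _ : Fin n => ℂ)) :
    ‖homEval c z.ofLp‖ ≤ ‖z‖ ^ m * polySup p c := by
  rcases eq_or_ne z 0 with rfl | hz
  · have := homEval_smul c 0 (0 : Fin n → ℂ)
    simp only [zero_mul, zero_pow hm] at this
    have h2 : homEval c (WithLp.ofLp (0 : PiLp p (fun _ : Fin n => ℂ))) = 0 := this
    rw [h2]
    simp [hm]
  · have hz' : (0 : ℝ) < ‖z‖ := norm_pos_iff.2 hz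
    have h1 : ‖((‖z‖ : ℂ)⁻¹) • z‖ ≤ 1 := by
      rw [norm_smul, norm_inv, Complex.norm_real, norm_norm, inv_mul_cancel₀ hz'.ne']
    have h2 := norm_homEval_le_polySup c h1
    have h3 := homEval_smul c ((‖z‖ : ℂ)⁻¹) z.ofLp
    have h4 : homEval c ((((‖z‖ : ℂ)⁻¹) • z).ofLp) = ((‖z‖ : ℂ)⁻¹) ^ m * homEval c z.ofLp := h3
    rw [h4, norm_mul, norm_pow, norm_inv, Complex.norm_real, norm_norm, inv_pow,
      inv_mul_le_iff₀ (pow_pos hz' m)] at h2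
    exact h2

/-- Schwarz lemma on the complex line through `w` and `z`. For `|t| ≤ 12` the point `w + t (z - w)`
has norm at most `1 + 1/m`, whose `m`-th power is below `e < 3`. Hence `g - g 0` is bounded by `6 K`
on the disc of radius `12`, and `6 / 12` is the factor `1/2`. -/
theorem norm_homEval_sub_le (c : MultiIndex n m → ℂ) (hm : m ≠ 0)
    {z w : PiLp p (fun _ : Fin n => ℂ)} (hw : ‖w‖ ≤ 1) (hzw : ‖z - w‖ ≤ 1 / (12 * m)) :
    ‖homEval c z.ofLp - homEval c w.ofLp‖ ≤ polySup p c / 2 := by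
  have hm' : (0 : ℝ) < m := by exact_mod_cast Nat.pos_of_ne_zero hm
  set K := polySup p c with hK
  have hK0 : 0 ≤ K := polySup_nonneg p c
  let g : ℂ → ℂ := fun t => homEval c (w + t • (z - w)).ofLp
  have hg : Differentiable ℂ g := by
    have : g = fun t => homEval c (fun i => w.ofLp i + t * (z.ofLp i - w.ofLp i)) := rfl
    rw [this]
    unfold homEval
    fun_prop
  have hbound : ∀ t : ℂ, ‖t‖ ≤ 12 → ‖g t‖ ≤ 3 * K := fun t ht => by
    refine (norm_homEval_le c hm _).trans (mul_le_mul_of_nonneg_right ?_ hK0)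
    have h1 : ‖w + t • (z - w)‖ ≤ 1 + 1 / m := by
      refine (norm_add_le _ _).trans (add_le_add hw ?_)
      rw [norm_smul]
      calc ‖t‖ * ‖z - w‖ ≤ 12 * (1 / (12 * m)) := by gcongr
        _ = 1 / m := by field_simp
    calc ‖w + t • (z - w)‖ ^ m ≤ (1 + 1 / m) ^ m := by gcongr
      _ ≤ (Real.exp (1 / m)) ^ m := by
        gcongr
        rw [add_comm]
        exact Real.add_one_le_exp _
      _ = Real.exp 1 := by
        rw [← Real.exp_nat_mul]
        congr 1
        field_simp
      _ ≤ 3 := Real.exp_one_lt_three.le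
  have hS := Complex.dist_le_div_mul_dist_of_mapsTo_ball (f := g) (c := 0) (z := 1) (R₁ := 12)
    (R₂ := 6 * K) hg.differentiableOn (fun t ht => by
      rw [Metric.mem_ball, dist_zero_right] at ht
      rw [Metric.mem_closedBall, dist_eq_norm]
      refine (norm_sub_le _ _).trans ?_
      have h1 := hbound t ht.le
      have h2 := hbound 0 (by simp)
      linarith) (by simp)
  have h1 : g 1 = homEval c z.ofLp := by simp [g]
  have h0 : g 0 = homEval c w.ofLp := by simp [g]
  rw [h1, h0, dist_eq_norm] at hS
  refine hS.trans (le_of_eq ?_)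
  simp
  ring

end

/-! ### Nets of the unit ball -/

/-- Volume comparison: the balls of radius `δ / 2` around the points are disjoint and lie in the
ball of radius `1 + δ / 2`. -/
theorem card_le_of_separated_unitBall {E : Type*} [NormedAddCommGroup E] [NormedSpace ℝ E]
    [FiniteDimensional ℝ E] {δ : ℝ} (hδ : 0 < δ) (s : Finset E) (hs : ∀ x ∈ s, ‖x‖ ≤ 1)
    (h : ∀ x ∈ s, ∀ y ∈ s, x ≠ y → δ ≤ ‖x - y‖) :
    (s.card : ℝ) ≤ (1 + 2 / δ) ^ Module.finrank ℝ E := by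
  borelize E
  let μ : Measure E := Measure.addHaar
  set η : ℝ := δ / 2 with hη
  have ηpos : 0 < η := by positivity
  set ρ : ℝ := 1 + η with hρ
  have ρpos : 0 < ρ := by positivity
  set A := ⋃ c ∈ s, Metric.ball (c : E) η with hA
  have D : Set.Pairwise (s : Set E) (Function.onFun Disjoint fun c => Metric.ball (c : E) η) := by
    rintro c hc d hd hcd
    apply Metric.ball_disjoint_ball
    rw [dist_eq_norm]
    have := h c hc d hd hcd
    linarith
  have A_subset : A ⊆ Metric.ball (0 : E) ρ := by
    refine Set.iUnion₂_subset fun x hx => ?_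
    apply Metric.ball_subset_ball'
    rw [dist_zero_right]
    linarith [hs x hx]
  have I : (s.card : ℝ≥0∞) * ENNReal.ofReal (η ^ Module.finrank ℝ E) * μ (Metric.ball 0 1) ≤
      ENNReal.ofReal (ρ ^ Module.finrank ℝ E) * μ (Metric.ball 0 1) :=
    calc
      _ = μ A := by
        rw [hA, measure_biUnion_finset D fun c _ => Metric.isOpen_ball.measurableSet]
        simp only [μ.addHaar_ball_of_pos _ ηpos]
        simp only [Finset.sum_const, nsmul_eq_mul, mul_assoc]
      _ ≤ μ (Metric.ball (0 : E) ρ) := measure_mono A_subset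
      _ = _ := by simp only [μ.addHaar_ball_of_pos _ ρpos]
  have J := (ENNReal.mul_le_mul_iff_left (Metric.measure_ball_pos _ _ zero_lt_one).ne'
    measure_ball_lt_top.ne).1 I
  have K := ENNReal.toReal_le_of_le_ofReal (pow_nonneg ρpos.le _) J
  rw [ENNReal.toReal_mul, ENNReal.toReal_natCast, ENNReal.toReal_ofReal (by positivity),
    ← le_div_iff₀ (by positivity), ← div_pow] at K
  refine K.trans (le_of_eq ?_)
  congr 1
  rw [hρ, hη]
  field_simp
  ring

/-- A separated set of maximal cardinality is a net; the volume bound ensures that the maximum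
exists. -/
theorem exists_net_unitBall {E : Type*} [NormedAddCommGroup E] [NormedSpace ℝ E]
    [FiniteDimensional ℝ E] {δ : ℝ} (hδ : 0 < δ) :
    ∃ s : Finset E, s.Nonempty ∧ (∀ x ∈ s, ‖x‖ ≤ 1) ∧ (∀ x, ‖x‖ ≤ 1 → ∃ y ∈ s, ‖x - y‖ ≤ δ) ∧
      (s.card : ℝ) ≤ (1 + 2 / δ) ^ Module.finrank ℝ E := by
  classical
  let Q : Finset E → Prop := fun s => (∀ x ∈ s, ‖x‖ ≤ 1) ∧
    (∀ x ∈ s, ∀ y ∈ s, x ≠ y → δ ≤ ‖x - y‖)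
  let N : ℕ → Prop := fun k => ∃ s, Q s ∧ s.card = k
  have hN0 : N 0 := ⟨∅, by simp [Q], rfl⟩
  have hbound : ∀ k, N k → k ≤ ⌊(1 + 2 / δ) ^ Module.finrank ℝ E⌋₊ := by
    rintro k ⟨s, hs, rfl⟩
    exact Nat.le_floor (card_le_of_separated_unitBall hδ s hs.1 hs.2)
  obtain ⟨s, hs, hcard⟩ := Nat.findGreatest_spec (P := N)
    (Nat.zero_le ⌊(1 + 2 / δ) ^ Module.finrank ℝ E⌋₊) hN0
  have hcov : ∀ x, ‖x‖ ≤ 1 → ∃ y ∈ s, ‖x - y‖ ≤ δ := by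
    intro x hx
    by_contra! hcon
    have hxs : x ∉ s := fun hxs => by
      have := hcon x hxs
      simp at this
      linarith
    have hQ : Q (insert x s) := by
      refine ⟨fun y hy => ?_, fun y hy y' hy' hne => ?_⟩
      · rcases Finset.mem_insert.1 hy with rfl | hy
        · exact hx
        · exact hs.1 y hy
      · rcases Finset.mem_insert.1 hy with h1 | h1 <;> rcases Finset.mem_insert.1 hy' with h2 | h2
        · exact absurd (h1.trans h2.symm) hne
        · rw [h1]
          exact (hcon y' h2).le
        · rw [h2, norm_sub_rev]
          exact (hcon y h1).le
        · exact hs.2 y h1 y' h2 hne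
    have h1 : N (s.card + 1) := ⟨_, hQ, Finset.card_insert_of_notMem hxs⟩
    have h2 := Nat.le_findGreatest (hbound _ h1) h1
    omega
  refine ⟨s, ?_, hs.1, hcov, card_le_of_separated_unitBall hδ s hs.1 hs.2⟩
  obtain ⟨y, hy, -⟩ := hcov 0 (by simp)
  exact ⟨y, hy⟩

theorem finrank_piLp_complex (p : ℝ≥0∞) (n : ℕ) :
    Module.finrank ℝ (PiLp p (fun _ : Fin n => ℂ)) = 2 * n := by
  rw [(WithLp.linearEquiv p ℝ (Fin n → ℂ)).finrank_eq, Module.finrank_pi_fintype]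
  simp [Complex.finrank_real_complex, mul_comm]

/-- The supremum of an `m`-homogeneous polynomial over the unit ball is, up to the factor `2`,
a maximum over a net of at most `(25 m)^(2 n)` points. -/
theorem exists_net_polySup_le (p : ℝ≥0∞) [Fact (1 ≤ p)] (n : ℕ) {m : ℕ} (hm : m ≠ 0) :
    ∃ s : Finset (PiLp p (fun _ : Fin n => ℂ)), s.Nonempty ∧ (∀ z ∈ s, ‖z‖ ≤ 1) ∧
      (s.card : ℝ) ≤ (25 * m) ^ (2 * n) ∧
      ∀ c : MultiIndex n m → ℂ, ∃ z ∈ s, polySup p c ≤ 2 * ‖homEval c z.ofLp‖ := by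
  have hm1 : (1 : ℝ) ≤ m := by exact_mod_cast Nat.one_le_iff_ne_zero.2 hm
  obtain ⟨s, hne, hs, hcov, hcard⟩ := exists_net_unitBall (E := PiLp p (fun _ : Fin n => ℂ))
    (δ := 1 / (12 * m)) (by positivity)
  refine ⟨s, hne, hs, hcard.trans ?_, fun c => ?_⟩
  · rw [finrank_piLp_complex]
    gcongr
    rw [div_div_eq_mul_div]
    linarith
  · obtain ⟨z, hz, hmax⟩ := s.exists_max_image (fun z => ‖homEval c z.ofLp‖) hne
    refine ⟨z, hz, ?_⟩
    have h : polySup p c ≤ ‖homEval c z.ofLp‖ + polySup p c / 2 := by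
      nth_rewrite 1 [polySup_eq]
      have : Nonempty {z : PiLp p (fun _ : Fin n => ℂ) // ‖z‖ ≤ 1} := ⟨⟨0, by simp⟩⟩
      refine ciSup_le fun x => ?_
      obtain ⟨y, hy, hxy⟩ := hcov x.1 x.2
      have h1 := norm_homEval_sub_le c hm (hs y hy) hxy
      have h2 := hmax y hy
      have h3 := norm_le_norm_add_norm_sub' (homEval c x.1.ofLp) (homEval c y.ofLp)
      linarith
    linarith

/-! ### Exponential moments and the Orlicz norm -/

/-- Layer cake formula. Halving the rate leaves `∫ (b/2) e^(bt/2) A e^(-bt) dt = A`, and `1` comes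
from `exp 0`. -/
theorem lintegral_exp_le_of_tail {Ω : Type*} [MeasurableSpace Ω] {μ : Measure Ω}
    [IsProbabilityMeasure μ] {Y : Ω → ℝ} (hY : AEMeasurable Y μ) (hY0 : ∀ ω, 0 ≤ Y ω) {A b : ℝ}
    (hA : 0 ≤ A) (hb : 0 < b)
    (htail : ∀ t, 0 < t → μ {ω | t ≤ Y ω} ≤ ENNReal.ofReal (A * Real.exp (-b * t))) :
    ∫⁻ ω, ENNReal.ofReal (Real.exp (b / 2 * Y ω)) ∂μ ≤ ENNReal.ofReal (1 + A) := by
  have hcont : Continuous fun t : ℝ => b / 2 * Real.exp (b / 2 * t) := by fun_prop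
  have hint : ∀ y : ℝ, ∫ t in (0 : ℝ)..y, b / 2 * Real.exp (b / 2 * t) =
      Real.exp (b / 2 * y) - 1 := fun y => by
    rw [intervalIntegral.integral_eq_sub_of_hasDerivAt (f := fun t => Real.exp (b / 2 * t))]
    · simp
    · intro t _
      have h := ((hasDerivAt_id t).const_mul (b / 2)).exp
      simpa [mul_comm] using h
    · exact hcont.intervalIntegrable _ _
  have hlayer := lintegral_comp_eq_lintegral_meas_le_mul μ (f := Y)
    (g := fun t => b / 2 * Real.exp (b / 2 * t)) (Filter.Eventually.of_forall hY0) hY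
    (fun t _ => hcont.intervalIntegrable _ _)
    (Filter.Eventually.of_forall fun t => by positivity)
  simp only [hint] at hlayer
  have hb2 : -(b / 2) < 0 := by linarith
  have hbound : ∫⁻ t in Set.Ioi (0 : ℝ), μ {ω | t ≤ Y ω} *
      ENNReal.ofReal (b / 2 * Real.exp (b / 2 * t)) ≤ ENNReal.ofReal A := by
    calc _ ≤ ∫⁻ t in Set.Ioi (0 : ℝ),
          ENNReal.ofReal (A * (b / 2) * Real.exp (-(b / 2) * t)) := by
          refine setLIntegral_mono' measurableSet_Ioi fun t ht => ?_
          refine (mul_le_mul_left (htail t ht) _).trans (le_of_eq ?_)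
          rw [← ENNReal.ofReal_mul (by positivity)]
          congr 1
          rw [show -(b / 2) * t = -b * t + b / 2 * t by ring, Real.exp_add]
          ring
      _ = ENNReal.ofReal (∫ t in Set.Ioi (0 : ℝ), A * (b / 2) * Real.exp (-(b / 2) * t)) := by
          rw [ofReal_integral_eq_lintegral_ofReal]
          · exact (integrableOn_exp_mul_Ioi hb2 0).const_mul _
          · exact Filter.Eventually.of_forall fun t => by positivity
      _ = ENNReal.ofReal A := by
          rw [integral_const_mul, integral_exp_mul_Ioi hb2]
          congr 1
          simp
          field_simp
  calc ∫⁻ ω, ENNReal.ofReal (Real.exp (b / 2 * Y ω)) ∂μ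
      ≤ ∫⁻ ω, (ENNReal.ofReal (Real.exp (b / 2 * Y ω) - 1) + 1) ∂μ := by
        refine lintegral_mono fun ω => ?_
        rw [← ENNReal.ofReal_one, ← ENNReal.ofReal_add _ zero_le_one]
        · simp
        · have := Real.one_le_exp (mul_nonneg (by positivity : 0 ≤ b / 2) (hY0 ω))
          linarith
    _ = (∫⁻ ω, ENNReal.ofReal (Real.exp (b / 2 * Y ω) - 1) ∂μ) + 1 := by
        rw [lintegral_add_right _ measurable_const]
        simp
    _ ≤ ENNReal.ofReal A + 1 := by
        rw [hlayer]
        gcongr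
    _ = ENNReal.ofReal (1 + A) := by
        rw [← ENNReal.ofReal_one, ← ENNReal.ofReal_add hA zero_le_one, add_comm]

theorem lintegral_rpow_inv_le {Ω : Type*} [MeasurableSpace Ω] {μ : Measure Ω}
    [IsProbabilityMeasure μ] {H : Ω → ℝ≥0∞} (hH : AEMeasurable H μ) {L : ℝ} (hL : 1 ≤ L) :
    ∫⁻ ω, H ω ^ (1 / L) ∂μ ≤ (∫⁻ ω, H ω ∂μ) ^ (1 / L) := by
  have hL0 : 0 < L := by linarith
  have h := eLpNorm'_le_eLpNorm'_of_exponent_le (p := 1 / L) (q := 1) (by positivity)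
    (by rw [div_le_one hL0]; exact hL) μ hH.aestronglyMeasurable
  simp only [eLpNorm', one_div, inv_inv, enorm_eq_self, ENNReal.rpow_one, inv_one] at h
  have h2 := ENNReal.rpow_le_rpow h (by positivity : 0 ≤ L⁻¹)
  rw [← ENNReal.rpow_mul, mul_inv_cancel₀ hL0.ne', ENNReal.rpow_one] at h2
  simpa only [one_div] using h2

theorem expOrliczNorm_le {Ω : Type u} [MeasurableSpace Ω] {μ : Measure Ω} {r : ℝ} {f : Ω → ℝ}
    {ε : ℝ} (hε : 0 < ε) (h : ∫⁻ ω, ENNReal.ofReal (expOrlicz r (|f ω| / ε)) ∂μ ≤ 1) :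
    expOrliczNorm r f μ ≤ ENNReal.ofReal ε :=
  iInf_le_of_le ε (iInf_le_of_le hε (iInf_le_of_le h le_rfl))

/-- A maximal inequality: the exponential Orlicz norm of a function dominated by a maximum of
finitely many variables with bounded exponential moments. -/
theorem expOrliczNorm_le_of_finset {Ω : Type u} [MeasurableSpace Ω] {μ : Measure Ω}
    [IsProbabilityMeasure μ] {ι : Type*} {s : Finset ι} {X : ι → Ω → ℝ} {f : Ω → ℝ} {r b A L : ℝ}
    (hr : 0 < r) (hb : 0 < b) (hL : 1 ≤ L) (hX : ∀ i ∈ s, Measurable (X i))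
    (hf : ∀ ω, ∃ i ∈ s, |f ω| ≤ 2 * X i ω)
    (hexp : ∀ i ∈ s, ∫⁻ ω, ENNReal.ofReal (Real.exp (b / 2 * X i ω ^ r)) ∂μ ≤
      ENNReal.ofReal (1 + A))
    (hcard : (s.card : ℝ) * (1 + A) ≤ 2 ^ L) :
    expOrliczNorm r f μ ≤ ENNReal.ofReal (2 * (2 * L / b) ^ (1 / r)) := by
  have hL0 : 0 < L := by linarith
  refine expOrliczNorm_le (by positivity) ?_
  -- Chosen so that `(2 X / ε)^r = (b/2) X^r / L`. The `L`-th root of the sum `H` of all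
  -- exponentials then dominates `exp ((|f|/ε)^r)`, and by Jensen its mean is at most `(2^L)^(1/L) =
  -- 2`.
  set ε : ℝ := 2 * (2 * L / b) ^ (1 / r) with hε
  have hε0 : 0 < ε := by positivity
  let H : Ω → ℝ≥0∞ := fun ω => ∑ i ∈ s, ENNReal.ofReal (Real.exp (b / 2 * X i ω ^ r))
  have hmeas : ∀ i ∈ s, Measurable fun ω => ENNReal.ofReal (Real.exp (b / 2 * X i ω ^ r)) :=
    fun i hi => by
      have := hX i hi
      fun_prop
  have hH : Measurable H := Finset.measurable_fun_sum s hmeas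
  have hHint : ∫⁻ ω, H ω ∂μ ≤ 2 ^ L := by
    rw [lintegral_finsetSum s hmeas]
    calc _ ≤ ∑ i ∈ s, ENNReal.ofReal (1 + A) := Finset.sum_le_sum hexp
      _ = ENNReal.ofReal (s.card * (1 + A)) := by
        rw [Finset.sum_const, nsmul_eq_mul, ENNReal.ofReal_mul (by positivity),
          ENNReal.ofReal_natCast]
      _ ≤ ENNReal.ofReal (2 ^ L) := ENNReal.ofReal_le_ofReal hcard
      _ = 2 ^ L := by
        rw [← ENNReal.ofReal_rpow_of_pos two_pos]
        simp
  have hpt : ∀ ω, ENNReal.ofReal (expOrlicz r (|f ω| / ε)) + 1 ≤ H ω ^ (1 / L) := fun ω => by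
    obtain ⟨i, hi, hfi⟩ := hf ω
    have hX0 : 0 ≤ X i ω := by linarith [abs_nonneg (f ω)]
    have hpow : (|f ω| / ε) ^ r ≤ b / 2 * X i ω ^ r * (1 / L) := by
      calc (|f ω| / ε) ^ r ≤ (2 * X i ω / ε) ^ r := by gcongr
        _ = (X i ω) ^ r / (2 * L / b) := by
          rw [hε, mul_div_mul_left _ _ two_ne_zero, Real.div_rpow hX0 (by positivity),
            ← Real.rpow_mul (by positivity), one_div, inv_mul_cancel₀ hr.ne', Real.rpow_one]
        _ = b / 2 * X i ω ^ r * (1 / L) := by field_simp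
    calc ENNReal.ofReal (expOrlicz r (|f ω| / ε)) + 1
        = ENNReal.ofReal (Real.exp ((|f ω| / ε) ^ r)) := by
          rw [expOrlicz, ← ENNReal.ofReal_one, ← ENNReal.ofReal_add _ zero_le_one]
          · simp
          · have := Real.one_le_exp (Real.rpow_nonneg
              (div_nonneg (abs_nonneg (f ω)) hε0.le) r)
            linarith
      _ ≤ ENNReal.ofReal (Real.exp (b / 2 * X i ω ^ r * (1 / L))) :=
          ENNReal.ofReal_le_ofReal (Real.exp_le_exp.2 hpow)
      _ = ENNReal.ofReal (Real.exp (b / 2 * X i ω ^ r)) ^ (1 / L) := by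
          rw [ENNReal.ofReal_rpow_of_pos (Real.exp_pos _), ← Real.exp_mul]
      _ ≤ H ω ^ (1 / L) := by
          refine ENNReal.rpow_le_rpow ?_ (by positivity)
          exact Finset.single_le_sum (f := fun i => ENNReal.ofReal (Real.exp (b / 2 * X i ω ^ r)))
            (fun _ _ => zero_le) hi
  have hsum : (∫⁻ ω, ENNReal.ofReal (expOrlicz r (|f ω| / ε)) ∂μ) + 1 ≤ 2 := by
    calc _ = ∫⁻ ω, (ENNReal.ofReal (expOrlicz r (|f ω| / ε)) + 1) ∂μ := by
          rw [lintegral_add_right _ measurable_const]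
          simp
      _ ≤ ∫⁻ ω, H ω ^ (1 / L) ∂μ := lintegral_mono hpt
      _ ≤ (∫⁻ ω, H ω ∂μ) ^ (1 / L) := lintegral_rpow_inv_le hH.aemeasurable hL
      _ ≤ (2 ^ L) ^ (1 / L) := ENNReal.rpow_le_rpow hHint (by positivity)
      _ = 2 := by
          rw [← ENNReal.rpow_mul, mul_one_div_cancel hL0.ne', ENNReal.rpow_one]
  rw [← one_add_one_eq_two] at hsum
  exact (ENNReal.add_le_add_iff_right ENNReal.one_ne_top).1 hsum

/-- Since `t ≤ exp (t^r) = φ_r(t) + 1` for `r ≥ 1`, every admissible `ε` satisfies `E f ≤ 2 ε`. The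
lower integral makes measurability of `f` unnecessary. -/
theorem le_expOrliczNorm {Ω : Type u} [MeasurableSpace Ω] {μ : Measure Ω}
    [IsProbabilityMeasure μ] {r K : ℝ} (hr : 1 ≤ r) {f : Ω → ℝ}
    (hK : ENNReal.ofReal K ≤ ∫⁻ ω, ENNReal.ofReal (f ω) ∂μ) :
    ENNReal.ofReal (K / 2) ≤ expOrliczNorm r f μ := by
  refine le_iInf fun ε => le_iInf fun hε => le_iInf fun h => ?_
  have hpt : ∀ ω, ENNReal.ofReal (f ω) ≤
      ENNReal.ofReal ε * (ENNReal.ofReal (expOrlicz r (|f ω| / ε)) + 1) := fun ω => by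
    set t := |f ω| / ε with ht
    have ht0 : 0 ≤ t := by positivity
    have h1 : t ≤ expOrlicz r t + 1 := by
      rw [expOrlicz, sub_add_cancel]
      rcases le_total t 1 with h1 | h1
      · exact h1.trans (Real.one_le_exp (Real.rpow_nonneg ht0 r))
      · calc t = t ^ (1 : ℝ) := (Real.rpow_one t).symm
          _ ≤ t ^ r := Real.rpow_le_rpow_of_exponent_le h1 hr
          _ ≤ t ^ r + 1 := by linarith
          _ ≤ Real.exp (t ^ r) := Real.add_one_le_exp _
    have h2 : 0 ≤ expOrlicz r t := by
      rw [expOrlicz]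
      linarith [Real.one_le_exp (Real.rpow_nonneg ht0 r)]
    rw [← ENNReal.ofReal_one, ← ENNReal.ofReal_add h2 zero_le_one, ← ENNReal.ofReal_mul hε.le]
    refine ENNReal.ofReal_le_ofReal ?_
    calc f ω ≤ |f ω| := le_abs_self _
      _ = ε * t := by rw [ht]; field_simp
      _ ≤ _ := by gcongr
  have h2 : ENNReal.ofReal K ≤ ENNReal.ofReal (ε * 2) := by
    calc _ ≤ _ := hK
      _ ≤ ∫⁻ ω, ENNReal.ofReal ε * (ENNReal.ofReal (expOrlicz r (|f ω| / ε)) + 1) ∂μ :=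
        lintegral_mono hpt
      _ = ENNReal.ofReal ε * ((∫⁻ ω, ENNReal.ofReal (expOrlicz r (|f ω| / ε)) ∂μ) + 1) := by
        rw [lintegral_const_mul' _ _ ENNReal.ofReal_ne_top,
          lintegral_add_right _ measurable_const]
        simp
      _ ≤ ENNReal.ofReal ε * (1 + 1) := by gcongr
      _ = ENNReal.ofReal (ε * 2) := by
        rw [ENNReal.ofReal_mul hε.le, one_add_one_eq_two]
        simp
  refine ENNReal.ofReal_le_ofReal ?_
  have h3 := (ENNReal.ofReal_le_ofReal_iff (by positivity)).1 h2
  linarith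

/-- Uniform exponential tails at the points of the unit ball bound the exponential Orlicz norm of
the supremum of a random homogeneous polynomial. -/
theorem expOrliczNorm_polySup_le {A : ℝ} (hA : 0 ≤ A) : ∃ C : ℝ, 1 ≤ C ∧
    ∀ r b : ℝ, 0 < r → 0 < b → ∀ p : ℝ≥0∞, 1 ≤ p → ∀ n m : ℕ, 1 ≤ n → 1 ≤ m →
      ∀ (Ω : Type u) [MeasurableSpace Ω] (μ : Measure Ω) [IsProbabilityMeasure μ]
        (γ : MultiIndex n m → Ω → ℂ), (∀ α, Measurable (γ α)) →
        (∀ z : PiLp p (fun _ : Fin n => ℂ), ‖z‖ ≤ 1 → ∀ t : ℝ, 0 < t →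
          μ {ω | t ≤ ‖homEval (fun α => γ α ω) z.ofLp‖} ≤
            ENNReal.ofReal (A * Real.exp (-b * t ^ r))) →
        expOrliczNorm r (fun ω => polySup p (fun α => γ α ω)) μ ≤
          ENNReal.ofReal (2 * (2 * (C * (n * (1 + Real.log m))) / b) ^ (1 / r)) := by
  have hlog2 := Real.log_pos one_lt_two
  have hlogA := Real.log_nonneg (by linarith : (1 : ℝ) ≤ 1 + A)
  have hlog25 := Real.log_pos (by norm_num : (1 : ℝ) < 25)
  have h252 : (1 : ℝ) ≤ Real.log 25 := by
    rw [Real.le_log_iff_exp_le (by norm_num)]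
    linarith [Real.exp_one_lt_three]
  -- The quotient absorbs `log ((25 m)^(2n) (1 + A))`, measured in units of `n (1 + log m) log 2`;
  -- the summand `1` ensures `C ≥ 1`, so that the exponent `L` is at least `1`.
  refine ⟨(2 * Real.log 25 + Real.log (1 + A)) / Real.log 2 + 1, ?_, ?_⟩
  · have : 0 ≤ (2 * Real.log 25 + Real.log (1 + A)) / Real.log 2 := by positivity
    linarith
  intro r b hr hb p hp n m hn hm Ω _ μ _ γ hγ htail
  have : Fact (1 ≤ p) := ⟨hp⟩
  set C := (2 * Real.log 25 + Real.log (1 + A)) / Real.log 2 + 1 with hC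
  have hn1 : (1 : ℝ) ≤ n := by exact_mod_cast hn
  have hm1 : (1 : ℝ) ≤ m := by exact_mod_cast hm
  have hlogm := Real.log_nonneg hm1
  have hQ : 1 ≤ n * (1 + Real.log m) := by nlinarith
  have hC1 : 1 ≤ C := by
    have : 0 ≤ (2 * Real.log 25 + Real.log (1 + A)) / Real.log 2 := by positivity
    linarith
  obtain ⟨s, -, hs, hcard, hsup⟩ := exists_net_polySup_le p n (Nat.one_le_iff_ne_zero.1 hm)
  have hmeas : ∀ z : PiLp p (fun _ : Fin n => ℂ),
      Measurable fun ω => homEval (fun α => γ α ω) z.ofLp := fun z => by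
    unfold homEval
    fun_prop
  refine expOrliczNorm_le_of_finset (s := s) (A := A)
    (X := fun z ω => ‖homEval (fun α => γ α ω) z.ofLp‖) hr hb ?_ ?_ ?_ ?_ ?_
  · nlinarith
  · exact fun z _ => (hmeas z).norm
  · intro ω
    obtain ⟨z, hz, h⟩ := hsup (fun α => γ α ω)
    refine ⟨z, hz, ?_⟩
    rw [abs_of_nonneg (polySup_nonneg _ _)]
    exact h
  · intro z hz
    refine lintegral_exp_le_of_tail ((hmeas z).norm.pow_const r).aemeasurable
      (fun ω => by positivity) hA hb fun t ht => ?_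
    have h1 := htail z (hs z hz) (t ^ (1 / r)) (by positivity)
    rw [← Real.rpow_mul ht.le, one_div, inv_mul_cancel₀ hr.ne', Real.rpow_one] at h1
    refine (measure_mono fun ω hω => ?_).trans h1
    simp only [Set.mem_ofPred_eq] at hω ⊢
    rw [Real.rpow_inv_le_iff_of_pos ht.le (norm_nonneg _) hr]
    exact hω
  · have h1 : (s.card : ℝ) * (1 + A) ≤ (25 * m) ^ (2 * n) * (1 + A) := by gcongr
    refine h1.trans ?_
    rw [← Real.log_le_log_iff (by positivity) (by positivity), Real.log_rpow two_pos,
      Real.log_mul (by positivity) (by positivity), Real.log_pow,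
      Real.log_mul (by norm_num) (by positivity)]
    have h2 : C * Real.log 2 = 2 * Real.log 25 + Real.log (1 + A) + Real.log 2 := by
      rw [hC]
      field_simp
    calc _ ≤ (2 * Real.log 25 + Real.log (1 + A)) * (n * (1 + Real.log m)) := by
          push_cast
          nlinarith [mul_nonneg (mul_nonneg (by linarith : (0 : ℝ) ≤ n) hlogm)
            (by linarith : (0 : ℝ) ≤ Real.log 25 - 1), mul_le_mul_of_nonneg_left hQ hlogA]
      _ ≤ (C * Real.log 2) * (n * (1 + Real.log m)) := by
          gcongr
          linarith
      _ = C * (n * (1 + Real.log m)) * Real.log 2 := by ring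

/-! ### Tails of weighted sums of subgaussian variables -/

section

variable {ι : Type*} [Fintype ι]

theorem HasSubgaussianBound.hasSubgaussianMGF {Ω : Type u} [MeasurableSpace Ω] {μ : Measure Ω}
    {f : Ω → ℂ} {s : ℝ} (hf : HasSubgaussianBound f μ s) (w : ℂ) :
    HasSubgaussianMGF (fun ω => (w * f ω).re) (s ^ 2 * ‖w‖ ^ 2).toNNReal μ where
  integrable_exp_mul t := by
    have h := (hf.2 (t * w)).1
    simpa only [mul_assoc, Complex.re_ofReal_mul] using h
  mgf_le t := by
    have h := (hf.2 (t * w)).2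
    simp only [mul_assoc, Complex.re_ofReal_mul] at h
    refine h.trans (le_of_eq ?_)
    rw [Real.coe_toNNReal _ (by positivity), norm_mul, Complex.norm_real, mul_pow,
      Real.norm_eq_abs, sq_abs]
    congr 1
    ring

theorem hasSubgaussianMGF_re_sum {Ω : Type u} [MeasurableSpace Ω] {μ : Measure Ω} {γ : ι → Ω → ℂ}
    {s S : ℝ} (hγ : iIndepFun γ μ) (hs : ∀ i, HasSubgaussianBound (γ i) μ s) {a : ι → ℂ}
    (ha : ∑ i, ‖a i‖ ^ 2 ≤ S) :
    HasSubgaussianMGF (fun ω => (∑ i, γ i ω * a i).re) (s ^ 2 * S).toNNReal μ := by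
  have hind : iIndepFun (fun i ω => (a i * γ i ω).re) μ :=
    hγ.comp (fun i x => (a i * x).re) (fun i => by fun_prop)
  have h := HasSubgaussianMGF.sum_of_iIndepFun hind (s := Finset.univ)
    (fun i _ => (hs i).hasSubgaussianMGF (a i))
  have heq : (fun ω => ∑ i, (a i * γ i ω).re) = fun ω => (∑ i, γ i ω * a i).re := by
    funext ω
    simp only [Complex.re_sum, mul_comm]
  rw [heq] at h
  refine ⟨h.integrable_exp_mul, fun t => (h.mgf_le t).trans (Real.exp_le_exp.2 ?_)⟩
  have hS : 0 ≤ S := (Finset.sum_nonneg fun i _ => by positivity).trans ha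
  rw [NNReal.coe_sum, Real.coe_toNNReal _ (by positivity),
    Finset.sum_congr rfl fun i _ => Real.coe_toNNReal _ (by positivity), ← Finset.mul_sum]
  gcongr

/-- Reduces the tail of a modulus to four one-sided real tails, at the cost of halving `t`. -/
theorem exists_re_ge_of_le_norm {t : ℝ} {x : ℂ} (h : t ≤ ‖x‖) :
    ∃ w ∈ ({1, -1, Complex.I, -Complex.I} : Finset ℂ), t / 2 ≤ (x * w).re := by
  have h1 := Complex.norm_le_abs_re_add_abs_im x
  by_cases h2 : t / 2 ≤ |x.re|
  · rcases le_abs.1 h2 with h3 | h3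
    · exact ⟨1, by simp, by simpa using h3⟩
    · exact ⟨-1, by simp, by simpa using h3⟩
  · have h4 : t / 2 ≤ |x.im| := by linarith
    rcases le_abs.1 h4 with h3 | h3
    · exact ⟨-Complex.I, by simp, by simpa using h3⟩
    · exact ⟨Complex.I, by simp, by simpa using h3⟩

/-- Chernoff bound at level `t / 2` in four directions. If `s ^ 2 * S = 0`, division by zero makes
the exponent `0` and the bound is the trivial `4`. -/
theorem measure_norm_sum_ge_le {Ω : Type u} [MeasurableSpace Ω] {μ : Measure Ω}
    [IsProbabilityMeasure μ] {γ : ι → Ω → ℂ}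
    {s S : ℝ} (hγ : iIndepFun γ μ) (hs : ∀ i, HasSubgaussianBound (γ i) μ s) {a : ι → ℂ}
    (ha : ∑ i, ‖a i‖ ^ 2 ≤ S) {t : ℝ} (ht : 0 < t) :
    μ {ω | t ≤ ‖∑ i, γ i ω * a i‖} ≤
      ENNReal.ofReal (4 * Real.exp (-(1 / (8 * s ^ 2 * S)) * t ^ (2 : ℝ))) := by
  have hS : 0 ≤ S := (Finset.sum_nonneg fun i _ => by positivity).trans ha
  set W : Finset ℂ := {1, -1, Complex.I, -Complex.I} with hW
  have hWcard : (W.card : ℝ) ≤ 4 := by exact_mod_cast Finset.card_le_four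
  have hWnorm : ∀ w ∈ W, ‖w‖ = 1 := by
    intro w hw
    simp only [hW, Finset.mem_insert, Finset.mem_singleton] at hw
    rcases hw with rfl | rfl | rfl | rfl <;> simp
  set e : ℝ := Real.exp (-(1 / (8 * s ^ 2 * S)) * t ^ (2 : ℝ)) with he
  have hone : ∀ w ∈ W, μ {ω | t / 2 ≤ ((∑ i, γ i ω * a i) * w).re} ≤ ENNReal.ofReal e := by
    intro w hw
    have h := hasSubgaussianMGF_re_sum hγ hs (a := fun i => a i * w) (S := S)
      (by simpa only [norm_mul, hWnorm w hw, mul_one] using ha)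
    have h2 := h.measure_ge_le (ε := t / 2) (by positivity)
    simp only [← mul_assoc, ← Finset.sum_mul] at h2
    rw [← ofReal_measureReal]
    refine ENNReal.ofReal_le_ofReal (h2.trans (le_of_eq ?_))
    rw [he, Real.coe_toNNReal _ (by positivity), Real.rpow_two]
    congr 1
    rw [neg_div, neg_mul, neg_inj, div_pow, div_div, one_div, inv_mul_eq_div]
    congr 1
    ring
  calc μ {ω | t ≤ ‖∑ i, γ i ω * a i‖}
      ≤ μ (⋃ w ∈ W, {ω | t / 2 ≤ ((∑ i, γ i ω * a i) * w).re}) := by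
        refine measure_mono fun ω hω => ?_
        obtain ⟨w, hw, h⟩ := exists_re_ge_of_le_norm hω
        exact Set.mem_iUnion₂.2 ⟨w, hw, h⟩
    _ ≤ ∑ w ∈ W, μ {ω | t / 2 ≤ ((∑ i, γ i ω * a i) * w).re} := measure_biUnion_finset_le _ _
    _ ≤ ∑ w ∈ W, ENNReal.ofReal e := Finset.sum_le_sum hone
    _ = ENNReal.ofReal (W.card * e) := by
        rw [Finset.sum_const, nsmul_eq_mul, ENNReal.ofReal_mul (by positivity),
          ENNReal.ofReal_natCast]
    _ ≤ ENNReal.ofReal (4 * e) := by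
        refine ENNReal.ofReal_le_ofReal ?_
        gcongr

/-- For bounded subgaussian variables and coefficients in the unit ball of `ℓ_q`, `1 < q < 2`,
the tails decay with the conjugate exponent `r`. -/
theorem measure_norm_sum_ge_le_of_bounded {Ω : Type u} [MeasurableSpace Ω] {μ : Measure Ω}
    [IsProbabilityMeasure μ] {γ : ι → Ω → ℂ} {s M r : ℝ} (hr : 2 < r) (hM : 0 < M)
    (hγ : iIndepFun γ μ) (hs : ∀ i, HasSubgaussianBound (γ i) μ s)
    (hbdd : ∀ i, ∀ᵐ ω ∂μ, ‖γ i ω‖ ≤ M) {a : ι → ℂ}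
    (ha : ∑ i, ‖a i‖ ^ (r / (r - 1)) ≤ 1) {t : ℝ} (ht : 0 < t) :
    μ {ω | t ≤ ‖∑ i, γ i ω * a i‖} ≤
      ENNReal.ofReal (4 * Real.exp (-((2 * M) ^ (2 - r) / (32 * s ^ 2)) * t ^ r)) := by
  have hr1 : 0 < r - 1 := by linarith
  set q : ℝ := r / (r - 1) with hq
  have hq1 : 1 - q = -(1 / (r - 1)) := by
    rw [hq]
    field_simp
    ring
  have hq2 : 2 - q = (r - 2) / (r - 1) := by
    rw [hq]
    field_simp
    ring
  have hqpos : 0 < q := by positivity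
  -- Coefficients are split at the level `l` with `l^(1-q) = x`. Those above `l` have `ℓ_1` norm at
  -- most `x`, so they contribute at most `M x = t / 2`. Those below have squared `ℓ_2` norm at most
  -- `l^(2-q) = x^(2-r)`, and the gaussian tail at `t / 2` with this variance has exponent of order
  -- `t^r`.
  set x : ℝ := t / (2 * M) with hx
  have hx0 : 0 < x := by positivity
  set l : ℝ := x ^ (-(r - 1)) with hl
  have hl0 : 0 < l := by positivity
  have hl1 : l ^ (1 - q) = x := by
    rw [hl, ← Real.rpow_mul hx0.le, hq1, neg_mul_neg, mul_one_div_cancel hr1.ne', Real.rpow_one]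
  have hl2 : l ^ (2 - q) = x ^ (2 - r) := by
    rw [hl, ← Real.rpow_mul hx0.le, hq2]
    congr 1
    field_simp
    ring
  let a' : ι → ℂ := fun i => if ‖a i‖ ≤ l then a i else 0
  have hsmall : ∑ i, ‖a' i‖ ^ 2 ≤ l ^ (2 - q) := by
    calc ∑ i, ‖a' i‖ ^ 2 ≤ ∑ i, l ^ (2 - q) * ‖a i‖ ^ q := by
          refine Finset.sum_le_sum fun i _ => ?_
          by_cases hi : ‖a i‖ ≤ l
          · simp only [a', if_pos hi]
            rcases (norm_nonneg (a i)).eq_or_lt with h0 | h0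
            · rw [← h0, zero_pow two_ne_zero]
              positivity
            · calc ‖a i‖ ^ 2 = ‖a i‖ ^ (2 - q) * ‖a i‖ ^ q := by
                    rw [← Real.rpow_add h0, ← Real.rpow_two]
                    congr 1
                    ring
                _ ≤ l ^ (2 - q) * ‖a i‖ ^ q := by
                    have : 0 ≤ 2 - q := by
                      rw [hq2]
                      exact div_nonneg (by linarith) hr1.le
                    gcongr
          · simp only [a', if_neg hi]
            simp only [norm_zero, ne_eq, OfNat.ofNat_ne_zero, not_false_eq_true, zero_pow]
            positivity
      _ ≤ l ^ (2 - q) := by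
          rw [← Finset.mul_sum]
          exact mul_le_of_le_one_right (by positivity) ha
  have hbig : ∑ i, ‖a i - a' i‖ ≤ x := by
    rw [← hl1]
    calc ∑ i, ‖a i - a' i‖ ≤ ∑ i, l ^ (1 - q) * ‖a i‖ ^ q := by
          refine Finset.sum_le_sum fun i _ => ?_
          by_cases hi : ‖a i‖ ≤ l
          · simp only [a', if_pos hi, sub_self, norm_zero]
            positivity
          · simp only [a', if_neg hi, sub_zero]
            push Not at hi
            calc ‖a i‖ = ‖a i‖ ^ (1 - q) * ‖a i‖ ^ q := by
                  rw [← Real.rpow_add (hl0.trans hi), sub_add_cancel, Real.rpow_one]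
              _ ≤ l ^ (1 - q) * ‖a i‖ ^ q := by
                  refine mul_le_mul_of_nonneg_right ?_ (by positivity)
                  refine Real.rpow_le_rpow_of_nonpos hl0 hi.le ?_
                  rw [hq1]
                  have : 0 < 1 / (r - 1) := by positivity
                  linarith
      _ ≤ l ^ (1 - q) := by
          rw [← Finset.mul_sum]
          exact mul_le_of_le_one_right (by positivity) ha
  have htail := measure_norm_sum_ge_le hγ hs hsmall (half_pos ht)
  calc μ {ω | t ≤ ‖∑ i, γ i ω * a i‖} ≤ μ {ω | t / 2 ≤ ‖∑ i, γ i ω * a' i‖} := by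
        refine measure_mono_ae ?_
        filter_upwards [ae_all_iff.2 hbdd] with ω hω h
        change t / 2 ≤ ‖∑ i, γ i ω * a' i‖
        have h : t ≤ ‖∑ i, γ i ω * a i‖ := h
        have h1 : ‖∑ i, γ i ω * (a i - a' i)‖ ≤ M * x := by
          calc _ ≤ ∑ i, ‖γ i ω * (a i - a' i)‖ := norm_sum_le _ _
            _ ≤ ∑ i, M * ‖a i - a' i‖ := by
              refine Finset.sum_le_sum fun i _ => ?_
              rw [norm_mul]
              gcongr
              exact hω i
            _ ≤ M * x := by
              rw [← Finset.mul_sum]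
              gcongr
        have h2 : M * x = t / 2 := by
          rw [hx]
          field_simp
        have h3 : ∑ i, γ i ω * a i = ∑ i, γ i ω * (a i - a' i) + ∑ i, γ i ω * a' i := by
          rw [← Finset.sum_add_distrib]
          exact Finset.sum_congr rfl fun i _ => by ring
        rw [h3] at h
        have h4 := norm_add_le (∑ i, γ i ω * (a i - a' i)) (∑ i, γ i ω * a' i)
        linarith
    _ ≤ _ := htail
    _ = _ := by
        congr 3
        rw [hl2, hx, Real.div_rpow ht.le (by positivity), Real.rpow_two]
        have h1 : t ^ r = t ^ 2 / t ^ (2 - r) := by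
          rw [← Real.rpow_two, ← Real.rpow_sub ht]
          congr 1
          ring
        rw [h1]
        have h2 : 0 < t ^ (2 - r) := by positivity
        have h3 : 0 < (2 * M) ^ (2 - r) := by positivity
        -- For `s = 0` both rates are `0` by the convention on division.
        rcases eq_or_ne s 0 with rfl | hs0
        · simp
        · field_simp
          norm_num

end

/-! ### The exponents -/

theorem rExp_eq {p : ℝ≥0∞} (hp : 1 < p) (hp' : p ≠ ∞) :
    rExp p = max (p.toReal / (p.toReal - 1)) 2 := by
  have h1 : p - 1 ≠ 0 := (tsub_pos_of_lt hp).ne'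
  have hc : ENNReal.conjExponent p ≠ ∞ := by
    rw [ENNReal.conjExponent]
    exact ENNReal.add_ne_top.2 ⟨ENNReal.one_ne_top, ENNReal.inv_ne_top.2 h1⟩
  have hq : 1 < p.toReal := by
    rw [← ENNReal.toReal_one]
    exact (ENNReal.toReal_lt_toReal ENNReal.one_ne_top hp').2 hp
  rw [rExp, ENNReal.toReal_max hc ENNReal.ofNat_ne_top]
  congr 1
  rw [ENNReal.conjExponent, ENNReal.toReal_add ENNReal.one_ne_top (ENNReal.inv_ne_top.2 h1),
    ENNReal.toReal_inv, ENNReal.toReal_sub_of_le hp.le hp', ENNReal.toReal_one]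
  have : p.toReal - 1 ≠ 0 := by linarith
  field_simp
  ring

theorem rExp_top : rExp ∞ = 2 := by
  simp [rExp, ENNReal.conjExponent]

theorem two_le_of_rExp_eq_two {p : ℝ≥0∞} (hp : 1 < p) (h : rExp p = 2) : 2 ≤ p := by
  rcases eq_or_ne p ∞ with rfl | hp'
  · exact le_top
  rw [rExp_eq hp hp'] at h
  have hq : 1 < p.toReal := by
    rw [← ENNReal.toReal_one]
    exact (ENNReal.toReal_lt_toReal ENNReal.one_ne_top hp').2 hp
  have h1 := le_max_left (p.toReal / (p.toReal - 1)) 2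
  rw [h, div_le_iff₀ (by linarith)] at h1
  have h2 : (2 : ℝ) ≤ p.toReal := by linarith
  rw [← ENNReal.ofReal_toReal hp']
  calc (2 : ℝ≥0∞) = ENNReal.ofReal 2 := by simp
    _ ≤ _ := ENNReal.ofReal_le_ofReal h2

theorem of_two_lt_rExp {p : ℝ≥0∞} (hp : 1 < p) (h : 2 < rExp p) :
    p ≠ ∞ ∧ 1 < p.toReal ∧ p.toReal < 2 ∧ rExp p = p.toReal / (p.toReal - 1) := by
  have hp' : p ≠ ∞ := by
    rintro rfl
    rw [rExp_top] at h
    exact lt_irrefl _ h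
  have hq : 1 < p.toReal := by
    rw [← ENNReal.toReal_one]
    exact (ENNReal.toReal_lt_toReal ENNReal.one_ne_top hp').2 hp
  rw [rExp_eq hp hp'] at h ⊢
  have h1 : 2 < p.toReal / (p.toReal - 1) := by
    rcases lt_max_iff.1 h with h | h
    · exact h
    · exact absurd h (lt_irrefl _)
  refine ⟨hp', hq, ?_, max_eq_left h1.le⟩
  rw [lt_div_iff₀ (by linarith)] at h1
  linarith

theorem two_le_rExp {p : ℝ≥0∞} (hp : 1 < p) : 2 ≤ rExp p := by
  rcases eq_or_ne p ∞ with rfl | hp'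
  · rw [rExp_top]
  · rw [rExp_eq hp hp']
    exact le_max_right _ _

theorem max_half_sub_eq_of_two_le {p : ℝ≥0∞} (hp : 2 ≤ p) :
    max (1 / 2 - (1 / p).toReal) 0 = 1 / 2 - (1 / p).toReal := by
  refine max_eq_left (sub_nonneg.2 ?_)
  have h : (1 / p).toReal ≤ (1 / 2 : ℝ≥0∞).toReal := by
    refine ENNReal.toReal_mono (by simp) ?_
    simpa using hp
  simpa using h

theorem max_half_sub_eq_zero {p : ℝ≥0∞} (hp : 1 < p.toReal) (hp2 : p.toReal < 2) :
    max (1 / 2 - (1 / p).toReal) 0 = 0 := by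
  refine max_eq_right (sub_nonpos.2 ?_)
  rw [one_div p, ENNReal.toReal_inv, one_div]
  gcongr

theorem sum_norm_rpow_le_one {p : ℝ≥0∞} (hp : 0 < p.toReal) {n : ℕ}
    {z : PiLp p (fun _ : Fin n => ℂ)} (hz : ‖z‖ ≤ 1) : ∑ i, ‖z.ofLp i‖ ^ p.toReal ≤ 1 := by
  rw [PiLp.norm_eq_sum hp] at hz
  have h0 : 0 ≤ ∑ i, ‖z.ofLp i‖ ^ p.toReal := Finset.sum_nonneg fun i _ => by positivity
  by_contra! h
  exact absurd hz (not_le.2 (Real.one_lt_rpow h (by positivity)))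

/-- Power mean inequality with exponent `p / 2`; at `p = ∞` the exponent on the right is `1`. -/
theorem sum_norm_sq_le {p : ℝ≥0∞} (hp : 2 ≤ p) {n : ℕ}
    {z : PiLp p (fun _ : Fin n => ℂ)} (hz : ‖z‖ ≤ 1) :
    ∑ i, ‖z.ofLp i‖ ^ 2 ≤ (n : ℝ) ^ (2 * (1 / 2 - (1 / p).toReal)) := by
  have : Fact (1 ≤ p) := ⟨one_le_two.trans hp⟩
  rcases eq_or_ne p ∞ with rfl | hp'
  · have h1 : ∀ i, ‖z.ofLp i‖ ^ 2 ≤ 1 := fun i =>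
      pow_le_one₀ (norm_nonneg _) ((PiLp.norm_apply_le z i).trans hz)
    calc ∑ i, ‖z.ofLp i‖ ^ 2 ≤ ∑ i : Fin n, (1 : ℝ) := Finset.sum_le_sum fun i _ => h1 i
      _ = _ := by simp
  · have hq : 2 ≤ p.toReal := by
      have := ENNReal.toReal_mono hp' hp
      simpa using this
    set q := p.toReal
    have h1 := sum_norm_rpow_le_one (by linarith : 0 < p.toReal) hz
    have h2 := Real.rpow_sum_le_const_mul_sum_rpow Finset.univ (fun i => ‖z.ofLp i‖ ^ 2)
      (p := q / 2) (by linarith)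
    simp only [abs_pow, abs_norm, Finset.card_univ, Fintype.card_fin] at h2
    have h3 : ∀ i, (‖z.ofLp i‖ ^ 2) ^ (q / 2) = ‖z.ofLp i‖ ^ q := fun i => by
      rw [← Real.rpow_two, ← Real.rpow_mul (norm_nonneg _)]
      congr 1
      ring
    simp only [h3] at h2
    have h4 : (∑ i, ‖z.ofLp i‖ ^ 2) ^ (q / 2) ≤ (n : ℝ) ^ (q / 2 - 1) :=
      h2.trans (mul_le_of_le_one_right (by positivity) h1)
    have h0 : 0 ≤ ∑ i, ‖z.ofLp i‖ ^ 2 := Finset.sum_nonneg fun i _ => by positivity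
    have h5 := Real.rpow_le_rpow (by positivity) h4 (by positivity : 0 ≤ (q / 2)⁻¹)
    rw [Real.rpow_rpow_inv h0 (by positivity), ← Real.rpow_mul (by positivity)] at h5
    refine h5.trans (le_of_eq ?_)
    congr 1
    rw [one_div p, ENNReal.toReal_inv]
    change _ = 2 * (1 / 2 - q⁻¹)
    field_simp

/-! ### Upper estimates -/

theorem norm_prod_pow {n : ℕ} (z : Fin n → ℂ) (α : Fin n → ℕ) :
    ‖∏ i, z i ^ α i‖ = ∏ i, ‖z i‖ ^ α i := by
  simp

theorem expOrliczNorm_polySup_le_of_two_le {s : ℝ} (hs : 0 < s) : ∃ C : ℝ, 0 < C ∧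
    ∀ p : ℝ≥0∞, 2 ≤ p → ∀ n m : ℕ, 1 ≤ n → 1 ≤ m →
      ∀ (Ω : Type u) [MeasurableSpace Ω] (μ : Measure Ω) [IsProbabilityMeasure μ]
        (γ : MultiIndex n m → Ω → ℂ), (∀ α, Measurable (γ α)) → iIndepFun γ μ →
        (∀ α, HasSubgaussianBound (γ α) μ s) →
        expOrliczNorm 2 (fun ω => polySup p (fun α => γ α ω)) μ ≤
          ENNReal.ofReal (C * ((n : ℝ) * (1 + Real.log m)) ^ (1 / 2 : ℝ) *
            (n : ℝ) ^ ((m : ℝ) * (1 / 2 - (1 / p).toReal))) := by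
  obtain ⟨C, hC, h⟩ := expOrliczNorm_polySup_le.{u} (A := 4) (by norm_num)
  refine ⟨2 * (16 * C * s ^ 2) ^ (1 / 2 : ℝ), by positivity, ?_⟩
  intro p hp n m hn hm Ω _ μ _ γ hmeas hind hsub
  have hn0 : (0 : ℝ) < n := by exact_mod_cast hn
  have hlog : 0 ≤ Real.log m := Real.log_nonneg (by exact_mod_cast hm)
  set e : ℝ := 1 / 2 - (1 / p).toReal with he
  -- The variance proxy of the monomials; its square root is the factor `n^(m e)` of the estimate.
  set S : ℝ := ((n : ℝ) ^ (2 * e)) ^ m with hS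
  have hS0 : 0 < S := by positivity
  refine (h 2 (1 / (8 * s ^ 2 * S)) two_pos (by positivity) p (one_le_two.trans hp) n m hn hm Ω μ γ
    hmeas fun z hz t ht => ?_).trans (ENNReal.ofReal_le_ofReal (le_of_eq ?_))
  · refine measure_norm_sum_ge_le hind hsub (a := fun α => ∏ i, z.ofLp i ^ α.1 i) ?_ ht
    simp only [norm_prod_pow, ← Finset.prod_pow, ← pow_mul, mul_comm _ 2]
    simp only [pow_mul]
    refine (sum_multiIndex_prod_pow_le fun i => by positivity).trans ?_
    have h0 : 0 ≤ ∑ i, ‖z.ofLp i‖ ^ 2 := Finset.sum_nonneg fun i _ => by positivity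
    exact pow_le_pow_left₀ h0 (sum_norm_sq_le hp hz) m
  · have h1 : 2 * (C * (n * (1 + Real.log m))) / (1 / (8 * s ^ 2 * S)) =
        (16 * C * s ^ 2) * (n * (1 + Real.log m)) * S := by
      field_simp
      ring
    have h2 : S ^ (1 / 2 : ℝ) = (n : ℝ) ^ ((m : ℝ) * e) := by
      rw [hS, ← Real.rpow_natCast, ← Real.rpow_mul hn0.le, ← Real.rpow_mul hn0.le]
      congr 1
      ring
    rw [h1, Real.mul_rpow (by positivity) hS0.le, Real.mul_rpow (by positivity) (by positivity), h2]
    ring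

theorem expOrliczNorm_polySup_le_of_bounded {r s M : ℝ} (hr : 2 < r) (hs : 0 < s) (hM : 0 < M) :
    ∃ C : ℝ, 0 < C ∧ ∀ p : ℝ≥0∞, 1 < p → rExp p = r → ∀ n m : ℕ, 1 ≤ n → 1 ≤ m →
      ∀ (Ω : Type u) [MeasurableSpace Ω] (μ : Measure Ω) [IsProbabilityMeasure μ]
        (γ : MultiIndex n m → Ω → ℂ), (∀ α, Measurable (γ α)) → iIndepFun γ μ →
        (∀ α, HasSubgaussianBound (γ α) μ s) → (∀ α, ∀ᵐ ω ∂μ, ‖γ α ω‖ ≤ M) →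
        expOrliczNorm r (fun ω => polySup p (fun α => γ α ω)) μ ≤
          ENNReal.ofReal (C * ((n : ℝ) * (1 + Real.log m)) ^ (1 / r)) := by
  obtain ⟨C, hC, h⟩ := expOrliczNorm_polySup_le.{u} (A := 4) (by norm_num)
  set b : ℝ := (2 * M) ^ (2 - r) / (32 * s ^ 2) with hb
  have hb0 : 0 < b := by positivity
  refine ⟨2 * (2 * C / b) ^ (1 / r), by positivity, ?_⟩
  intro p hp hpr n m hn hm Ω _ μ _ γ hmeas hind hsub hbdd
  have hn0 : (0 : ℝ) < n := by exact_mod_cast hn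
  have hlog : 0 ≤ Real.log m := Real.log_nonneg (by exact_mod_cast hm)
  obtain ⟨-, hq1, hq2, hrq⟩ := of_two_lt_rExp hp (hpr.symm ▸ hr)
  rw [hpr] at hrq
  refine (h r b (by linarith) hb0 p hp.le n m hn hm Ω μ γ
    hmeas fun z hz t ht => ?_).trans (ENNReal.ofReal_le_ofReal (le_of_eq ?_))
  · refine measure_norm_sum_ge_le_of_bounded hr hM hind hsub hbdd
      (a := fun α => ∏ i, z.ofLp i ^ α.1 i) ?_ ht
    have hrq' : r / (r - 1) = p.toReal := by
      have h1 : p.toReal - 1 ≠ 0 := by linarith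
      have h2 : r - 1 = 1 / (p.toReal - 1) := by
        rw [hrq]
        field_simp
        ring
      rw [h2, hrq]
      field_simp
    rw [hrq']
    have h1 : ∀ α : MultiIndex n m, ‖∏ i, z.ofLp i ^ α.1 i‖ ^ p.toReal =
        ∏ i, (‖z.ofLp i‖ ^ p.toReal) ^ α.1 i := fun α => by
      rw [norm_prod_pow, ← Real.finsetProd_rpow _ _ fun i _ => by positivity]
      refine Finset.prod_congr rfl fun i _ => ?_
      rw [← Real.rpow_natCast, ← Real.rpow_natCast, ← Real.rpow_mul (norm_nonneg _),
        ← Real.rpow_mul (norm_nonneg _), mul_comm]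
    simp only [h1]
    refine (sum_multiIndex_prod_pow_le fun i => by positivity).trans ?_
    exact pow_le_one₀ (Finset.sum_nonneg fun i _ => by positivity)
      (sum_norm_rpow_le_one (by linarith) hz)
  · have h1 : 2 * (C * (n * (1 + Real.log m))) / b = (2 * C / b) * (n * (1 + Real.log m)) := by
      field_simp
    rw [h1, Real.mul_rpow (by positivity) (by positivity)]
    ring

/-- A strictly larger `t` avoids having to show that the infimum `sg` is attained. -/
theorem IsSubgaussian.hasSubgaussianBound {Ω : Type u} [MeasurableSpace Ω] {f : Ω → ℂ}
    {μ : Measure Ω} {s t : ℝ} (hf : IsSubgaussian f μ) (hs : sg f μ ≤ s) (hst : s < t) :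
    HasSubgaussianBound f μ t := by
  obtain ⟨v, hv, hvt⟩ := exists_lt_of_csInf_lt (s := {s : ℝ | HasSubgaussianBound f μ s}) hf
    (hs.trans_lt hst)
  have hv : HasSubgaussianBound f μ v := hv
  refine ⟨hv.1.trans hvt.le, fun z => ⟨(hv.2 z).1, (hv.2 z).2.trans (Real.exp_le_exp.2 ?_)⟩⟩
  have := hv.1
  gcongr

/-! ### A deterministic lower estimate -/

/-- The multi-indices whose part on `B` is the `j`-th unit vector. -/
def linearIndices {n : ℕ} (m : ℕ) (B : Finset (Fin n)) (j : Fin n) : Finset (MultiIndex n m) :=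
  Finset.univ.filter fun α => α.1 j = 1 ∧ ∀ i ∈ B, i ≠ j → α.1 i = 0

theorem mem_linearIndices {n m : ℕ} {B : Finset (Fin n)} {j : Fin n} {α : MultiIndex n m} :
    α ∈ linearIndices m B j ↔ α.1 j = 1 ∧ ∀ i ∈ B, i ≠ j → α.1 i = 0 := by
  simp [linearIndices]

/-- Adding the unit vector `e_j` injects the multi-indices of degree `m - 1` supported off `B` into
the set to be counted. -/
theorem pow_card_compl_le_card_linearIndices {n m : ℕ} (hm : 1 ≤ m) {B : Finset (Fin n)}
    {j : Fin n} (hj : j ∈ B) :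
    Bᶜ.card ^ (m - 1) ≤ (linearIndices m B j).card * (m - 1).factorial := by
  refine (pow_card_le_card_piAntidiag Bᶜ (m - 1)).trans (Nat.mul_le_mul_right _ ?_)
  have hmem : ∀ β ∈ Bᶜ.piAntidiag (m - 1), β + Pi.single j 1 ∈
      (Finset.univ : Finset (Fin n)).piAntidiag m := fun β hβ => by
    rw [Finset.mem_piAntidiag] at hβ ⊢
    refine ⟨?_, fun _ _ => Finset.mem_univ _⟩
    have h1 : ∑ i, β i = m - 1 := by
      rw [← hβ.1]
      refine (Finset.sum_subset (Finset.subset_univ _) fun i _ hi => ?_).symm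
      by_contra h
      exact hi (hβ.2 i h)
    simp only [Pi.add_apply, Finset.sum_add_distrib, h1]
    simp
    omega
  have hzero : ∀ β ∈ Bᶜ.piAntidiag (m - 1), ∀ i ∈ B, β i = 0 := fun β hβ i hi => by
    by_contra h
    exact Finset.mem_compl.1 ((Finset.mem_piAntidiag.1 hβ).2 i h) hi
  rw [← Finset.card_attach]
  refine Finset.card_le_card_of_injOn (fun β => ⟨β.1 + Pi.single j 1, hmem β.1 β.2⟩) ?_ ?_
  · intro β _
    rw [Finset.mem_coe, mem_linearIndices]
    refine ⟨?_, fun i hi hij => ?_⟩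
    · simp [hzero β.1 β.2 j hj]
    · simp [hzero β.1 β.2 i hi, hij]
  · intro β _ β' _ h
    have h1 := congrArg Subtype.val h
    exact Subtype.ext (add_right_cancel h1)

theorem sum_filter_eq_sum_linearIndices {n m : ℕ} (B : Finset (Fin n))
    (g : MultiIndex n m → ℂ) :
    ∑ α with ∑ i ∈ B, α.1 i = 1, g α = ∑ j ∈ B, ∑ α ∈ linearIndices m B j, g α := by
  classical
  rw [← Finset.sum_biUnion]
  · congr 1
    ext α
    simp only [Finset.mem_filter, Finset.mem_univ, true_and, Finset.mem_biUnion, mem_linearIndices]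
    constructor
    · intro h
      obtain ⟨j, hj, hj0⟩ : ∃ j ∈ B, α.1 j ≠ 0 := by
        by_contra! hcon
        rw [Finset.sum_eq_zero hcon] at h
        omega
      have h1 := Finset.add_sum_erase B α.1 hj
      have h2 : α.1 j = 1 ∧ ∑ i ∈ B.erase j, α.1 i = 0 := by omega
      refine ⟨j, hj, h2.1, fun i hi hij => ?_⟩
      exact Finset.sum_eq_zero_iff.1 h2.2 i (Finset.mem_erase.2 ⟨hij, hi⟩)
    · rintro ⟨j, hj, h1, h2⟩
      rw [Finset.sum_eq_single_of_mem j hj h2, h1]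
  · intro j hj k hk hjk
    refine Finset.disjoint_left.2 fun α h1 h2 => ?_
    have h3 := (mem_linearIndices.1 h1).2 k hk (Ne.symm hjk)
    have h4 := (mem_linearIndices.1 h2).1
    omega

/-- Modulo `m + 1` the exponent `d + m` is `d - 1`, and for `0 ≤ d ≤ m` it vanishes only at `d = 1`.
-/
theorem sum_rootsOfUnity_pow_add {m d : ℕ} (hm : 1 ≤ m) (hd : d ≤ m) {ζ : ℂ}
    (hζ : IsPrimitiveRoot ζ (m + 1)) :
    ∑ k ∈ Finset.range (m + 1), (ζ ^ (d + m)) ^ k = if d = 1 then (m + 1 : ℂ) else 0 := by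
  split_ifs with h
  · rw [h, add_comm 1 m, hζ.pow_eq_one]
    simp
  · have h1 : ζ ^ (d + m) ≠ 1 := by
      rw [Ne, hζ.pow_eq_one_iff_dvd]
      rintro ⟨k, hk⟩
      rcases k with _ | _ | k
      · omega
      · omega
      · have : (m + 1) * (k + 1 + 1) = (m + 1) * k + 2 * (m + 1) := by ring
        omega
    rw [geom_sum_eq h1, ← pow_mul, mul_comm, pow_mul, hζ.pow_eq_one]
    simp

theorem exists_norm_one_mul_eq_norm (x : ℂ) : ∃ u : ℂ, ‖u‖ = 1 ∧ u * x = ‖x‖ := by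
  rcases eq_or_ne x 0 with rfl | hx
  · exact ⟨1, by simp⟩
  · have h : (‖x‖ : ℂ) ≠ 0 := by exact_mod_cast norm_ne_zero_iff.2 hx
    refine ⟨‖x‖ / x, ?_, by field_simp⟩
    rw [norm_div, Complex.norm_real, norm_norm, div_self (norm_ne_zero_iff.2 hx)]

/-- A lower bound for the supremum through the part of the polynomial that is linear in the
variables from `B`. -/
theorem sum_norm_linear_part_le_polySup {p : ℝ≥0∞} [Fact (1 ≤ p)] {n m : ℕ} (hm : 1 ≤ m)
    {B : Finset (Fin n)} {a b : ℝ} (ha : 0 ≤ a) (hb : 0 ≤ b)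
    (hball : ∀ z : PiLp p (fun _ : Fin n => ℂ), (∀ i, ‖z.ofLp i‖ = if i ∈ B then b else a) →
      ‖z‖ ≤ 1) (c : MultiIndex n m → ℂ) :
    a ^ (m - 1) * b * ∑ j ∈ B, ‖∑ α ∈ linearIndices m B j, c α‖ ≤ polySup p c := by
  choose u hu1 hu using fun j => exists_norm_one_mul_eq_norm (∑ α ∈ linearIndices m B j, c α)
  have hζ := Complex.isPrimitiveRoot_exp (m + 1) (Nat.succ_ne_zero m)
  set ζ : ℂ := Complex.exp (2 * Real.pi * Complex.I / ((m + 1 : ℕ) : ℂ)) with hζdef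
  have hζ1 : ‖ζ‖ = 1 := hζ.norm'_eq_one (Nat.succ_ne_zero m)
  -- The phases `u i` make every linear coefficient contribute its modulus. Below, `z k` rotates the
  -- block `B` by `ζ ^ k`, which preserves all moduli and hence membership in the ball.
  let w : Fin n → ℂ := fun i => if i ∈ B then b * u i else a
  let d : MultiIndex n m → ℕ := fun α => ∑ i ∈ B, α.1 i
  let g : MultiIndex n m → ℂ := fun α => c α * ∏ i, w i ^ α.1 i
  have hd : ∀ α, d α ≤ m := fun α => by
    rw [← α.sum_eq]
    exact Finset.sum_le_sum_of_subset (Finset.subset_univ _)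
  let z : ℕ → PiLp p (fun _ : Fin n => ℂ) := fun k =>
    WithLp.toLp p fun i => (if i ∈ B then ζ ^ k else 1) * w i
  have hz : ∀ k, ‖z k‖ ≤ 1 := fun k => hball _ fun i => by
    by_cases hi : i ∈ B
    · simp [z, w, hi, hζ1, hu1, abs_of_nonneg hb]
    · simp [z, w, hi, abs_of_nonneg ha]
  have heval : ∀ k, homEval c (z k).ofLp = ∑ α, (ζ ^ d α) ^ k * g α := fun k => by
    refine Finset.sum_congr rfl fun α _ => ?_
    have h1 : ∏ i, ((if i ∈ B then ζ ^ k else 1) : ℂ) ^ α.1 i = (ζ ^ d α) ^ k := by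
      simp only [ite_pow, one_pow, Finset.prod_ite_mem, Finset.univ_inter,
        Finset.prod_pow_eq_pow_sum, d]
      rw [← pow_mul, ← pow_mul, mul_comm]
    simp only [z, g, mul_pow, Finset.prod_mul_distrib, h1]
    ring
  have hproj : ∑ k ∈ Finset.range (m + 1), (ζ ^ m) ^ k * homEval c (z k).ofLp =
      (m + 1) * ∑ α with d α = 1, g α := by
    simp only [heval, Finset.mul_sum]
    rw [Finset.sum_comm, Finset.sum_filter]
    refine Finset.sum_congr rfl fun α _ => ?_
    have h1 := sum_rootsOfUnity_pow_add hm (hd α) hζ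
    calc ∑ k ∈ Finset.range (m + 1), (ζ ^ m) ^ k * ((ζ ^ d α) ^ k * g α)
        = (∑ k ∈ Finset.range (m + 1), (ζ ^ (d α + m)) ^ k) * g α := by
          rw [Finset.sum_mul]
          refine Finset.sum_congr rfl fun k _ => ?_
          rw [pow_add, mul_pow]
          ring
      _ = _ := by
          rw [h1]
          split_ifs <;> simp
  have hnorm : ‖∑ α with d α = 1, g α‖ ≤ polySup p c := by
    have h1 : ‖∑ k ∈ Finset.range (m + 1), (ζ ^ m) ^ k * homEval c (z k).ofLp‖ ≤
        (m + 1) * polySup p c := by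
      calc _ ≤ ∑ k ∈ Finset.range (m + 1), ‖(ζ ^ m) ^ k * homEval c (z k).ofLp‖ :=
            norm_sum_le _ _
        _ ≤ ∑ k ∈ Finset.range (m + 1), polySup p c := by
            refine Finset.sum_le_sum fun k _ => ?_
            rw [norm_mul, norm_pow, norm_pow, hζ1, one_pow, one_pow, one_mul]
            exact norm_homEval_le_polySup c (hz k)
        _ = _ := by simp
    rw [hproj, norm_mul] at h1
    have h2 : ‖(m + 1 : ℂ)‖ = m + 1 := by
      exact_mod_cast Complex.norm_natCast (m + 1)
    rw [h2] at h1
    exact le_of_mul_le_mul_left h1 (by positivity)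
  have hlin : ∑ α with d α = 1, g α =
      ((a ^ (m - 1) * b * ∑ j ∈ B, ‖∑ α ∈ linearIndices m B j, c α‖ : ℝ) : ℂ) := by
    rw [sum_filter_eq_sum_linearIndices]
    push_cast
    rw [Finset.mul_sum]
    refine Finset.sum_congr rfl fun j hj => ?_
    rw [← hu j, Finset.mul_sum, Finset.mul_sum]
    refine Finset.sum_congr rfl fun α hα => ?_
    obtain ⟨h1, h2⟩ := mem_linearIndices.1 hα
    have hB : ∏ i ∈ B, w i ^ α.1 i = b * u j := by
      rw [Finset.prod_eq_single_of_mem j hj fun i hi hij => by rw [h2 i hi hij, pow_zero], h1]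
      simp [w, hj]
    have hBsum : ∑ i ∈ B, α.1 i = 1 := by
      rw [Finset.sum_eq_single_of_mem j hj h2, h1]
    have hBc : ∏ i ∈ Bᶜ, w i ^ α.1 i = (a : ℂ) ^ (m - 1) := by
      have h3 := Finset.sum_add_sum_compl B α.1
      rw [α.sum_eq, hBsum] at h3
      have h4 : m - 1 = ∑ i ∈ Bᶜ, α.1 i := by omega
      rw [h4, ← Finset.prod_pow_eq_pow_sum]
      refine Finset.prod_congr rfl fun i hi => ?_
      simp [w, Finset.mem_compl.1 hi]
    simp only [g]
    rw [← Finset.prod_mul_prod_compl B, hB, hBc]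
    ring
  rw [hlin, Complex.norm_real] at hnorm
  exact (le_abs_self _).trans hnorm

/-! ### Standardized subgaussian variables -/

/-- A centered variable with unit second moment and subgaussian constant at most `1`. -/
structure IsStdSubgaussian {Ω : Type u} [MeasurableSpace Ω] (f : Ω → ℂ) (μ : Measure Ω) :
    Prop where
  bound : HasSubgaussianBound f μ 1
  integral_re : ∫ ω, (f ω).re ∂μ = 0
  integral_im : ∫ ω, (f ω).im ∂μ = 0
  integral_norm_sq : ∫ ω, ‖f ω‖ ^ 2 ∂μ = 1

theorem integral_sq_re_sum {Ω : Type u} [MeasurableSpace Ω] {μ : Measure Ω}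
    [IsProbabilityMeasure μ] {ι : Type*} {X : ι → Ω → ℝ} (hind : iIndepFun X μ)
    (hL : ∀ i, MemLp (X i) 2 μ) (h0 : ∀ i, ∫ ω, X i ω ∂μ = 0) (T : Finset ι) :
    ∫ ω, (∑ i ∈ T, X i ω) ^ 2 ∂μ = ∑ i ∈ T, ∫ ω, X i ω ^ 2 ∂μ := by
  have h1 := IndepFun.variance_sum (s := T) (fun i _ => hL i)
    (fun i _ j _ hij => hind.indepFun hij)
  have hsum : MemLp (∑ i ∈ T, X i) 2 μ := memLp_finsetSum' _ fun i _ => hL i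
  have h2 : ∫ ω, (∑ i ∈ T, X i) ω ∂μ = 0 := by
    simp only [Finset.sum_apply]
    rw [integral_finsetSum _ fun i _ => (hL i).integrable one_le_two]
    exact Finset.sum_eq_zero fun i _ => h0 i
  rw [variance_of_integral_eq_zero hsum.aemeasurable h2] at h1
  simp only [Finset.sum_apply] at h1
  rw [h1]
  exact Finset.sum_congr rfl fun i _ => variance_of_integral_eq_zero (hL i).aemeasurable (h0 i)

/-- A Khinchin type inequality. -/
theorem exists_le_lintegral_norm_sum : ∃ c : ℝ, 0 < c ∧
    ∀ (Ω : Type u) [MeasurableSpace Ω] (μ : Measure Ω) [IsProbabilityMeasure μ]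
      (ι : Type) [Fintype ι] (γ : ι → Ω → ℂ), (∀ i, Measurable (γ i)) → iIndepFun γ μ →
      (∀ i, IsStdSubgaussian (γ i) μ) → ∀ T : Finset ι,
      ENNReal.ofReal (c * √T.card) ≤ ∫⁻ ω, ENNReal.ofReal ‖∑ i ∈ T, γ i ω‖ ∂μ := by
  classical
  -- The mean is bounded below by interpolating between the second moment, exactly `N`, and the
  -- fourth, at most `2560 N²`.
  refine ⟨1 / (2 * √5120), by positivity, ?_⟩
  intro Ω _ μ _ ι _ γ hmeas hind hstd T
  rcases T.eq_empty_or_nonempty with rfl | hT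
  · simp
  have hN : (0 : ℝ) < T.card := by exact_mod_cast hT.card_pos
  set N : ℝ := (T.card : ℝ) with hNdef
  set X : Ω → ℝ := fun ω => ‖∑ i ∈ T, γ i ω‖ with hX
  have hXm : Measurable X := by fun_prop
  have hX0 : ∀ ω, 0 ≤ X ω := fun ω => norm_nonneg _
  have hre : ∀ i, MemLp (fun ω => (γ i ω).re) 2 μ := fun i => by
    have h := ((hstd i).bound.hasSubgaussianMGF 1).memLp 2
    simpa using h
  have him : ∀ i, MemLp (fun ω => (γ i ω).im) 2 μ := fun i => by
    have h := ((hstd i).bound.hasSubgaussianMGF (-Complex.I)).memLp 2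
    simpa using h
  have hsecond : ∫⁻ ω, ENNReal.ofReal (X ω ^ 2) ∂μ = ENNReal.ofReal N := by
    have h1 := integral_sq_re_sum (hind.comp (fun _ => Complex.re) fun _ => Complex.measurable_re)
      hre (fun i => (hstd i).integral_re) T
    have h2 := integral_sq_re_sum (hind.comp (fun _ => Complex.im) fun _ => Complex.measurable_im)
      him (fun i => (hstd i).integral_im) T
    have hres : MemLp (fun ω => ∑ i ∈ T, (γ i ω).re) 2 μ := memLp_finsetSum _ fun i _ => hre i
    have hims : MemLp (fun ω => ∑ i ∈ T, (γ i ω).im) 2 μ := memLp_finsetSum _ fun i _ => him i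
    have hsq : ∀ x : ℂ, ‖x‖ ^ 2 = x.re ^ 2 + x.im ^ 2 := fun x => by
      rw [Complex.sq_norm, Complex.normSq_apply]
      ring
    have hXsq : (fun ω => X ω ^ 2) =
        fun ω => (∑ i ∈ T, (γ i ω).re) ^ 2 + (∑ i ∈ T, (γ i ω).im) ^ 2 := by
      funext ω
      simp only [hX, hsq, Complex.re_sum, Complex.im_sum]
    have hint : Integrable (fun ω => X ω ^ 2) μ := by
      rw [hXsq]
      exact hres.integrable_sq.add hims.integrable_sq
    rw [← ofReal_integral_eq_lintegral_ofReal hint (Filter.Eventually.of_forall fun ω =>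
      sq_nonneg _)]
    congr 1
    rw [hXsq, integral_add hres.integrable_sq hims.integrable_sq]
    simp only [Function.comp_apply] at h1 h2
    rw [h1, h2, ← Finset.sum_add_distrib]
    have h3 : ∀ i ∈ T, ∫ ω, (γ i ω).re ^ 2 ∂μ + ∫ ω, (γ i ω).im ^ 2 ∂μ = 1 := fun i _ => by
      rw [← integral_add (hre i).integrable_sq (him i).integrable_sq, ← (hstd i).integral_norm_sq]
      simp only [hsq]
    rw [Finset.sum_congr rfl h3]
    simp [hNdef]
  have hexp : ∫⁻ ω, ENNReal.ofReal (Real.exp (1 / (8 * N) / 2 * X ω ^ 2)) ∂μ ≤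
      ENNReal.ofReal 5 := by
    have h := lintegral_exp_le_of_tail (μ := μ) (Y := fun ω => X ω ^ 2) (A := 4) (b := 1 / (8 * N))
      (hXm.pow_const 2).aemeasurable (fun ω => sq_nonneg _) (by norm_num) (by positivity)
      fun t ht => ?_
    · norm_num at h ⊢
      exact h
    · have h1 := measure_norm_sum_ge_le hind (fun i => (hstd i).bound)
        (a := fun i => if i ∈ T then 1 else 0) (S := N) (by simp [hNdef, apply_ite])
        (Real.sqrt_pos.2 ht)
      simp only [mul_ite, mul_one, mul_zero, Finset.sum_ite_mem, Finset.univ_inter, one_pow,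
        Real.rpow_two, Real.sq_sqrt ht.le] at h1
      refine (measure_mono fun ω hω => ?_).trans h1
      exact Real.sqrt_le_iff.2 ⟨hX0 ω, hω⟩
  -- With `y = X² / (16 N)` one has `X⁴ = 512 N² (y² / 2) ≤ 512 N² e^y`, and `e^y` has mean at most
  -- `5`.
  have hfourth : ∫⁻ ω, ENNReal.ofReal (X ω ^ 4) ∂μ ≤ ENNReal.ofReal (2560 * N ^ 2) := by
    calc _ ≤ ∫⁻ ω, ENNReal.ofReal (512 * N ^ 2) *
          ENNReal.ofReal (Real.exp (1 / (8 * N) / 2 * X ω ^ 2)) ∂μ := by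
          refine lintegral_mono fun ω => ?_
          rw [← ENNReal.ofReal_mul (by positivity)]
          refine ENNReal.ofReal_le_ofReal ?_
          have h1 := Real.quadratic_le_exp_of_nonneg
            (by positivity : 0 ≤ 1 / (8 * N) / 2 * X ω ^ 2)
          set y := 1 / (8 * N) / 2 * X ω ^ 2 with hy
          have h2 : X ω ^ 4 = 512 * N ^ 2 * (y ^ 2 / 2) := by
            rw [hy]
            field_simp
            ring
          rw [h2]
          have h3 : 0 ≤ y := by positivity
          gcongr
          linarith
      _ = ENNReal.ofReal (512 * N ^ 2) *
          ∫⁻ ω, ENNReal.ofReal (Real.exp (1 / (8 * N) / 2 * X ω ^ 2)) ∂μ :=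
          lintegral_const_mul' _ _ ENNReal.ofReal_ne_top
      _ ≤ ENNReal.ofReal (512 * N ^ 2) * ENNReal.ofReal 5 := by gcongr
      _ = ENNReal.ofReal (2560 * N ^ 2) := by
          rw [← ENNReal.ofReal_mul (by positivity)]
          congr 1
          ring
  -- Makes the fourth-moment term in `x² ≤ l x + l⁻² x⁴` equal to `N / 2`, half of the second
  -- moment.
  set l : ℝ := √(5120 * N) with hl
  have hl0 : 0 < l := by positivity
  have hl2 : l ^ 2 = 5120 * N := Real.sq_sqrt (by positivity)
  have hpt : ∀ x : ℝ, 0 ≤ x → x ^ 2 ≤ l * x + (l ^ 2)⁻¹ * x ^ 4 := fun x hx => by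
    rcases le_total x l with h | h
    · have : 0 ≤ (l ^ 2)⁻¹ * x ^ 4 := by positivity
      nlinarith
    · have h1 : x ^ 2 ≤ (l ^ 2)⁻¹ * x ^ 4 := by
        rw [inv_mul_eq_div, le_div_iff₀ (by positivity)]
        have : l ^ 2 ≤ x ^ 2 := by gcongr
        nlinarith [sq_nonneg x]
      have : 0 ≤ l * x := by positivity
      linarith
  have hmain : ENNReal.ofReal (N / 2) + ENNReal.ofReal (N / 2) ≤
      ENNReal.ofReal l * (∫⁻ ω, ENNReal.ofReal (X ω) ∂μ) + ENNReal.ofReal (N / 2) := by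
    rw [← ENNReal.ofReal_add (by positivity) (by positivity), add_halves, ← hsecond]
    calc ∫⁻ ω, ENNReal.ofReal (X ω ^ 2) ∂μ
        ≤ ∫⁻ ω, (ENNReal.ofReal l * ENNReal.ofReal (X ω) +
          ENNReal.ofReal (l ^ 2)⁻¹ * ENNReal.ofReal (X ω ^ 4)) ∂μ := by
          refine lintegral_mono fun ω => ?_
          have := hX0 ω
          rw [← ENNReal.ofReal_mul hl0.le, ← ENNReal.ofReal_mul (by positivity),
            ← ENNReal.ofReal_add (by positivity) (by positivity)]
          exact ENNReal.ofReal_le_ofReal (hpt _ this)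
      _ = ENNReal.ofReal l * (∫⁻ ω, ENNReal.ofReal (X ω) ∂μ) +
          ENNReal.ofReal (l ^ 2)⁻¹ * ∫⁻ ω, ENNReal.ofReal (X ω ^ 4) ∂μ := by
          rw [lintegral_add_left (by fun_prop), lintegral_const_mul' _ _ ENNReal.ofReal_ne_top,
            lintegral_const_mul' _ _ ENNReal.ofReal_ne_top]
      _ ≤ _ := by
          gcongr
          calc _ ≤ ENNReal.ofReal (l ^ 2)⁻¹ * ENNReal.ofReal (2560 * N ^ 2) := by gcongr
            _ = ENNReal.ofReal (N / 2) := by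
              rw [← ENNReal.ofReal_mul (by positivity), hl2]
              congr 1
              field_simp
              norm_num
  have h1 := (ENNReal.add_le_add_iff_right ENNReal.ofReal_ne_top).1 hmain
  have h2 : 1 / (2 * √5120) * √N = (N / 2) / l := by
    rw [hl, Real.sqrt_mul (by norm_num)]
    have h4 : 0 < √N := Real.sqrt_pos.2 hN
    have h5 : 0 < √(5120 : ℝ) := by positivity
    field_simp
    exact Real.sq_sqrt hN.le
  rw [h2, ENNReal.ofReal_div_of_pos hl0]
  exact ENNReal.div_le_of_le_mul' h1

/-! ### The special distributions are standardized subgaussian -/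

theorem HasSubgaussianBound.of_map {Ω Ω' : Type*} [MeasurableSpace Ω] [MeasurableSpace Ω']
    {μ : Measure Ω} {g : Ω → Ω'} {f : Ω' → ℂ} {s : ℝ} (hg : Measurable g) (hf : Measurable f) :
    HasSubgaussianBound f (μ.map g) s ↔ HasSubgaussianBound (f ∘ g) μ s := by
  refine and_congr_right fun _ => forall_congr' fun z => ?_
  have hm : Measurable fun x => Real.exp (z * f x).re := by fun_prop
  rw [integrable_map_measure hm.aestronglyMeasurable hg.aemeasurable,
    integral_map hg.aemeasurable hm.aestronglyMeasurable]
  rfl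

theorem isStdSubgaussian_map_iff {Ω : Type u} [MeasurableSpace Ω] {μ : Measure Ω} {f : Ω → ℂ}
    (hf : Measurable f) : IsStdSubgaussian (fun x : ℂ => x) (μ.map f) ↔ IsStdSubgaussian f μ := by
  have h1 := HasSubgaussianBound.of_map (μ := μ) (s := 1) hf (f := fun x : ℂ => x) measurable_id
  have h2 : ∫ x, x.re ∂(μ.map f) = ∫ ω, (f ω).re ∂μ :=
    integral_map hf.aemeasurable Complex.measurable_re.aestronglyMeasurable
  have h3 : ∫ x, x.im ∂(μ.map f) = ∫ ω, (f ω).im ∂μ :=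
    integral_map hf.aemeasurable Complex.measurable_im.aestronglyMeasurable
  have h4 : ∫ x, ‖x‖ ^ 2 ∂(μ.map f) = ∫ ω, ‖f ω‖ ^ 2 ∂μ :=
    integral_map hf.aemeasurable (measurable_norm.pow_const 2).aestronglyMeasurable
  exact ⟨fun h => ⟨h1.1 h.1, h2 ▸ h.2, h3 ▸ h.3, h4 ▸ h.4⟩,
    fun h => ⟨h1.2 h.1, h2.trans h.2, h3.trans h.3, h4.trans h.4⟩⟩

/-- Hoeffding's lemma for the centered variable `Re (z x)` with values in `[-|z|, |z|]` gives
exactly the constant `1`. -/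
theorem isStdSubgaussian_of_symmetric {ν : Measure ℂ} [IsProbabilityMeasure ν]
    (h1 : ∀ᵐ x ∂ν, ‖x‖ = 1) (hsymm : ν.map (fun x => -x) = ν) :
    IsStdSubgaussian (fun x : ℂ => x) ν := by
  have hmean : ∀ w : ℂ, ∫ x, (w * x).re ∂ν = 0 := fun w => by
    have h : ∫ x, (w * x).re ∂(ν.map fun x => -x) = ∫ x, (w * -x).re ∂ν :=
      integral_map measurable_neg.aemeasurable
        (by fun_prop : Measurable fun x : ℂ => (w * x).re).aestronglyMeasurable
    rw [hsymm] at h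
    simp only [mul_neg, Complex.neg_re, integral_neg] at h
    linarith
  refine ⟨⟨zero_le_one, fun z => ?_⟩, ?_, ?_, ?_⟩
  · have h := hasSubgaussianMGF_of_mem_Icc_of_integral_eq_zero (μ := ν)
      (X := fun x => (z * x).re) (a := -‖z‖) (b := ‖z‖) (by fun_prop) (by
        filter_upwards [h1] with x hx
        have := Complex.abs_re_le_norm (z * x)
        rw [norm_mul, hx, mul_one] at this
        exact abs_le.1 this) (hmean z)
    have h2 := h.integrable_exp_mul 1
    have h3 := h.mgf_le 1
    simp only [mgf, one_mul] at h2 h3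
    refine ⟨h2, h3.trans (le_of_eq ?_)⟩
    congr 1
    have h4 : |‖z‖ + ‖z‖| / 2 = ‖z‖ := by
      rw [abs_of_nonneg (by positivity)]
      ring
    simp [h4]
  · simpa using hmean 1
  · simpa using hmean (-Complex.I)
  · have : ∫ x, ‖x‖ ^ 2 ∂ν = ∫ _, (1 : ℝ) ∂ν := by
      refine integral_congr_ae ?_
      filter_upwards [h1] with x hx
      simp [hx]
    rw [this]
    simp

instance : IsProbabilityMeasure rademacherLaw := by
  constructor
  simp [rademacherLaw, ENNReal.inv_two_add_inv_two]

theorem norm_eq_one_rademacherLaw : ∀ᵐ x ∂rademacherLaw, ‖x‖ = 1 := by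
  have hm : MeasurableSet {x : ℂ | ‖x‖ = 1} := measurable_norm (measurableSet_singleton 1)
  rw [rademacherLaw, ae_add_measure_iff]
  constructor <;> refine Measure.ae_smul_measure ((ae_dirac_iff hm).2 ?_) _ <;> simp

theorem measurable_toCircle_coe :
    Measurable fun t : AddCircle (1 : ℝ) => (AddCircle.toCircle t : ℂ) :=
  (continuous_subtype_val.comp AddCircle.continuous_toCircle).measurable

instance : IsProbabilityMeasure steinhausLaw :=
  Measure.isProbabilityMeasure_map measurable_toCircle_coe.aemeasurable

theorem norm_eq_one_steinhausLaw : ∀ᵐ x ∂steinhausLaw, ‖x‖ = 1 := by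
  have hm : MeasurableSet {x : ℂ | ‖x‖ = 1} := measurable_norm (measurableSet_singleton 1)
  rw [steinhausLaw, ae_map_iff measurable_toCircle_coe.aemeasurable hm]
  exact Filter.Eventually.of_forall fun t => Circle.norm_coe _

theorem isStdSubgaussian_rademacherLaw : IsStdSubgaussian (fun x : ℂ => x) rademacherLaw := by
  refine isStdSubgaussian_of_symmetric norm_eq_one_rademacherLaw ?_
  have h : ∀ x : ℂ, (Measure.dirac x).map (fun x => -x) = Measure.dirac (-x) := fun x =>
    Measure.map_dirac' measurable_neg x
  rw [rademacherLaw, Measure.map_add _ _ measurable_neg, Measure.map_smul, Measure.map_smul,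
    h, h, neg_neg, add_comm]

theorem isStdSubgaussian_steinhausLaw : IsStdSubgaussian (fun x : ℂ => x) steinhausLaw := by
  refine isStdSubgaussian_of_symmetric norm_eq_one_steinhausLaw ?_
  rw [steinhausLaw, Measure.map_map measurable_neg measurable_toCircle_coe]
  -- Negation on the circle is translation by `1/2` in `ℝ / ℤ`, which preserves Haar measure.
  have h : ((fun x : ℂ => -x) ∘ fun t : AddCircle (1 : ℝ) => (AddCircle.toCircle t : ℂ)) =
      (fun t : AddCircle (1 : ℝ) => (AddCircle.toCircle t : ℂ)) ∘
        fun t => ((1 / 2 : ℝ) : AddCircle (1 : ℝ)) + t := by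
    funext t
    simp only [Function.comp_apply, AddCircle.toCircle_add, Circle.coe_mul]
    have h2 : (AddCircle.toCircle ((1 / 2 : ℝ) : AddCircle (1 : ℝ)) : ℂ) = -1 := by
      rw [AddCircle.toCircle_apply_mk, Circle.coe_exp, ← Complex.exp_pi_mul_I]
      congr 2
      push_cast
      ring
    rw [h2, neg_one_mul]
  rw [h, ← Measure.map_map measurable_toCircle_coe (measurable_const_add _), map_add_left_eq_self]

theorem integral_exp_mul_gaussianReal (v : ℝ≥0) (t : ℝ) :
    ∫ x, Real.exp (t * x) ∂(gaussianReal 0 v) = Real.exp (v * t ^ 2 / 2) := by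
  have h := congrFun (mgf_id_gaussianReal (μ := 0) (v := v)) t
  simpa [mgf] using h

theorem integral_sq_gaussianReal (v : ℝ≥0) : ∫ x, x ^ 2 ∂(gaussianReal 0 v) = v := by
  have h := variance_id_gaussianReal (μ := 0) (v := v)
  rw [variance_of_integral_eq_zero aemeasurable_id (by simp)] at h
  simpa using h

theorem isStdSubgaussian_realNormalLaw : IsStdSubgaussian (fun x : ℂ => x) realNormalLaw := by
  rw [realNormalLaw, isStdSubgaussian_map_iff (by fun_prop)]
  refine ⟨(hasSubgaussianBound_ofReal_iff (fun x : ℝ => x) _ 1).2 ⟨zero_le_one, fun x =>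
    ⟨integrable_exp_mul_gaussianReal x, ?_⟩⟩, by simp, by simp, ?_⟩
  · rw [integral_exp_mul_gaussianReal]
    simp
  · simpa using integral_sq_gaussianReal 1

/-- The exponential moment at `z` is `exp (|z|² / 4)`, below the permitted `exp (|z|² / 2)`. -/
theorem isStdSubgaussian_complexNormalLaw :
    IsStdSubgaussian (fun x : ℂ => x) complexNormalLaw := by
  rw [complexNormalLaw, isStdSubgaussian_map_iff (by fun_prop)]
  have hid : Integrable (fun x : ℝ => x) (gaussianReal 0 (1 / 2)) :=
    (memLp_id_gaussianReal (μ := 0) (v := 1 / 2) 1).integrable le_rfl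
  have hsq : Integrable (fun x : ℝ => x ^ 2) (gaussianReal 0 (1 / 2)) :=
    (memLp_id_gaussianReal (μ := 0) (v := 1 / 2) 2).integrable_sq
  refine ⟨⟨zero_le_one, fun z => ?_⟩, ?_, ?_, ?_⟩
  · have h : (fun x : ℝ × ℝ => Real.exp (z * ((x.1 : ℂ) + (x.2 : ℂ) * Complex.I)).re) =
        fun x => Real.exp (z.re * x.1) * Real.exp (-z.im * x.2) := by
      funext x
      rw [← Real.exp_add]
      congr 1
      simp
      ring
    rw [h]
    refine ⟨(integrable_exp_mul_gaussianReal z.re).mul_prod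
      (integrable_exp_mul_gaussianReal (-z.im)), ?_⟩
    rw [integral_prod_mul (fun x => Real.exp (z.re * x)) (fun x => Real.exp (-z.im * x)),
      integral_exp_mul_gaussianReal, integral_exp_mul_gaussianReal, ← Real.exp_add,
      Real.exp_le_exp, Complex.sq_norm, Complex.normSq_apply]
    push_cast
    nlinarith [sq_nonneg z.re, sq_nonneg z.im]
  · simp only [Complex.add_re, Complex.ofReal_re, Complex.re_ofReal_mul, Complex.I_re, mul_zero,
      add_zero]
    rw [integral_fun_fst (fun x : ℝ => x)]
    simp
  · simp only [Complex.add_im, Complex.ofReal_im, Complex.im_ofReal_mul, Complex.I_im, mul_one,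
      zero_add]
    rw [integral_fun_snd (fun x : ℝ => x)]
    simp
  · have h : (fun x : ℝ × ℝ => ‖(x.1 : ℂ) + (x.2 : ℂ) * Complex.I‖ ^ 2) =
        fun x => x.1 ^ 2 + x.2 ^ 2 := by
      funext x
      rw [Complex.sq_norm, Complex.normSq_add_mul_I]
    rw [h, integral_add (hsq.comp_fst _) (hsq.comp_snd _), integral_fun_fst (fun x : ℝ => x ^ 2),
      integral_fun_snd (fun x : ℝ => x ^ 2), integral_sq_gaussianReal]
    simp
    norm_num

/-! ### Lower estimates -/

/-- The deterministic estimate, integrated, with the Khinchin bound `hK` applied to each linear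
coefficient. The set `B` and the moduli `a`, `b` are left free for the two ranges of `p`. -/
theorem lintegral_polySup_ge {c₀ : ℝ} {n m : ℕ} (hm : 1 ≤ m) (hc₀ : 0 ≤ c₀) {p : ℝ≥0∞}
    [Fact (1 ≤ p)] {Ω : Type u} [MeasurableSpace Ω] {μ : Measure Ω} {γ : MultiIndex n m → Ω → ℂ}
    (hγ : ∀ α, Measurable (γ α))
    (hK : ∀ T : Finset (MultiIndex n m),
      ENNReal.ofReal (c₀ * √T.card) ≤ ∫⁻ ω, ENNReal.ofReal ‖∑ i ∈ T, γ i ω‖ ∂μ)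
    {B : Finset (Fin n)} {a b : ℝ} (ha : 0 ≤ a) (hb : 0 ≤ b)
    (hball : ∀ z : PiLp p (fun _ : Fin n => ℂ), (∀ i, ‖z.ofLp i‖ = if i ∈ B then b else a) →
      ‖z‖ ≤ 1) :
    ENNReal.ofReal (a ^ (m - 1) * b * (B.card *
      (c₀ * √((Bᶜ.card : ℝ) ^ (m - 1) / (m - 1).factorial)))) ≤
      ∫⁻ ω, ENNReal.ofReal (polySup p fun α => γ α ω) ∂μ := by
  calc _ = ENNReal.ofReal (a ^ (m - 1) * b) * ∑ j ∈ B,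
        ENNReal.ofReal (c₀ * √((Bᶜ.card : ℝ) ^ (m - 1) / (m - 1).factorial)) := by
        rw [Finset.sum_const, nsmul_eq_mul, ENNReal.ofReal_mul (by positivity),
          ENNReal.ofReal_mul (by positivity : (0 : ℝ) ≤ B.card), ENNReal.ofReal_natCast]
    _ ≤ ENNReal.ofReal (a ^ (m - 1) * b) *
        ∑ j ∈ B, ∫⁻ ω, ENNReal.ofReal ‖∑ α ∈ linearIndices m B j, γ α ω‖ ∂μ := by
        gcongr with j hj
        refine (ENNReal.ofReal_le_ofReal ?_).trans (hK _)
        gcongr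
        rw [div_le_iff₀ (by positivity)]
        exact_mod_cast pow_card_compl_le_card_linearIndices hm hj
    _ = ∫⁻ ω, ENNReal.ofReal (a ^ (m - 1) * b) *
        ∑ j ∈ B, ENNReal.ofReal ‖∑ α ∈ linearIndices m B j, γ α ω‖ ∂μ := by
        rw [lintegral_const_mul' _ _ ENNReal.ofReal_ne_top, lintegral_finsetSum _ fun j _ => ?_]
        fun_prop
    _ ≤ _ := by
        refine lintegral_mono fun ω => ?_
        rw [← ENNReal.ofReal_sum_of_nonneg fun j _ => norm_nonneg _,
          ← ENNReal.ofReal_mul (by positivity)]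
        exact ENNReal.ofReal_le_ofReal (sum_norm_linear_part_le_polySup hm ha hb hball _)

theorem norm_le_one_of_norm_apply_eq {p : ℝ≥0∞} [Fact (1 ≤ p)] {n : ℕ} {B : Finset (Fin n)}
    {a b : ℝ} (htop : p = ∞ → a ≤ 1 ∧ b ≤ 1)
    (hsum : p ≠ ∞ → B.card * b ^ p.toReal + Bᶜ.card * a ^ p.toReal ≤ 1)
    (z : PiLp p (fun _ : Fin n => ℂ)) (hz : ∀ i, ‖z.ofLp i‖ = if i ∈ B then b else a) :
    ‖z‖ ≤ 1 := by
  have hp1 : 1 ≤ p := Fact.out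
  rcases eq_or_ne p ∞ with rfl | hp
  · rw [PiLp.norm_eq_ciSup]
    refine Real.iSup_le (fun i => ?_) zero_le_one
    rw [hz]
    split_ifs
    exacts [(htop rfl).2, (htop rfl).1]
  · have hp0 : 0 < p.toReal := ENNReal.toReal_pos (zero_lt_one.trans_le hp1).ne' hp
    rw [PiLp.norm_eq_sum hp0]
    refine Real.rpow_le_one (Finset.sum_nonneg fun i _ => by positivity) ?_ (by positivity)
    refine le_trans (le_of_eq ?_) (hsum hp)
    rw [← Finset.sum_add_sum_compl B]
    congr 1
    · rw [Finset.sum_congr rfl fun i hi => by rw [hz, if_pos hi], Finset.sum_const, nsmul_eq_mul]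
    · rw [Finset.sum_congr rfl fun i hi => by rw [hz, if_neg (Finset.mem_compl.1 hi)],
        Finset.sum_const, nsmul_eq_mul]

/-- All moduli are `n^(-1/p)` and `|B| = ⌊n/2⌋ ≥ n/3`, as `n ≥ 2`. The order is `n^(-m/p) · n ·
n^((m-1)/2)`, the last factor being the Khinchin gain. -/
theorem lintegral_polySup_ge_of_two_le {c₀ : ℝ} (hc₀ : 0 < c₀) {p : ℝ≥0∞} (hp : 2 ≤ p) {n m : ℕ}
    (hn : 2 ≤ n) (hm : 1 ≤ m) {Ω : Type u} [MeasurableSpace Ω] {μ : Measure Ω}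
    {γ : MultiIndex n m → Ω → ℂ} (hγ : ∀ α, Measurable (γ α))
    (hK : ∀ T : Finset (MultiIndex n m),
      ENNReal.ofReal (c₀ * √T.card) ≤ ∫⁻ ω, ENNReal.ofReal ‖∑ i ∈ T, γ i ω‖ ∂μ) :
    ENNReal.ofReal (c₀ / 3 * √((1 / 2) ^ (m - 1) / (m - 1).factorial) *
      (n : ℝ) ^ (1 / 2 + (m : ℝ) * (1 / 2 - (1 / p).toReal))) ≤
      ∫⁻ ω, ENNReal.ofReal (polySup p fun α => γ α ω) ∂μ := by
  have : Fact (1 ≤ p) := ⟨one_le_two.trans hp⟩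
  obtain ⟨B, -, hB⟩ := Finset.exists_subset_card_eq (s := (Finset.univ : Finset (Fin n)))
    (n := n / 2) (by simp; omega)
  have hBc : Bᶜ.card = n - n / 2 := by rw [Finset.card_compl, Fintype.card_fin, hB]
  have hn0 : (0 : ℝ) < n := by exact_mod_cast (by omega : 0 < n)
  have hBcard : (n : ℝ) / 3 ≤ B.card := by
    rw [div_le_iff₀ (by norm_num), hB]
    exact_mod_cast (by omega : n ≤ n / 2 * 3)
  have hBccard : (n : ℝ) / 2 ≤ Bᶜ.card := by
    rw [div_le_iff₀ (by norm_num), hBc]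
    exact_mod_cast (by omega : n ≤ (n - n / 2) * 2)
  have hBB : (B.card : ℝ) + Bᶜ.card = n := by
    rw [hB, hBc]
    exact_mod_cast (by omega : n / 2 + (n - n / 2) = n)
  set q : ℝ := (1 / p).toReal with hq
  set a : ℝ := (n : ℝ) ^ (-q) with ha
  have ha0 : 0 < a := by positivity
  refine le_trans (ENNReal.ofReal_le_ofReal ?_) (lintegral_polySup_ge hm hc₀.le hγ hK
    (B := B) ha0.le ha0.le (norm_le_one_of_norm_apply_eq ?_ ?_))
  · set d : ℝ := (1 / 2) ^ (m - 1) / (m - 1).factorial with hd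
    have hexp : ((m - 1 : ℕ) : ℝ) = m - 1 := by
      push_cast [hm]
      ring
    have h1 : √d * √((n : ℝ) ^ (m - 1)) ≤
        √((Bᶜ.card : ℝ) ^ (m - 1) / (m - 1).factorial) := by
      rw [← Real.sqrt_mul (by positivity)]
      refine Real.sqrt_le_sqrt ?_
      calc d * (n : ℝ) ^ (m - 1) = ((n : ℝ) / 2) ^ (m - 1) / (m - 1).factorial := by
            rw [hd, div_pow, div_pow, one_pow]
            ring
        _ ≤ _ := by gcongr
    have h2 : (n : ℝ) ^ (1 / 2 + (m : ℝ) * (1 / 2 - q)) =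
        a ^ (m - 1) * a * (n * √((n : ℝ) ^ (m - 1))) := by
      rw [← pow_succ, Nat.sub_add_cancel hm, ha, Real.sqrt_eq_rpow, ← Real.rpow_natCast,
        ← Real.rpow_natCast, ← Real.rpow_mul hn0.le, ← Real.rpow_mul hn0.le,
        ← Real.rpow_one_add' hn0.le, ← Real.rpow_add hn0]
      · congr 1
        rw [hexp]
        ring
      · positivity
    calc c₀ / 3 * √d * (n : ℝ) ^ (1 / 2 + (m : ℝ) * (1 / 2 - q))
        = a ^ (m - 1) * a * (n / 3 * (c₀ * (√d * √((n : ℝ) ^ (m - 1))))) := by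
          rw [h2]
          ring
      _ ≤ _ := by gcongr
  · rintro rfl
    simp [ha, hq]
  · intro hp'
    have hp0 : p.toReal ≠ 0 :=
      (ENNReal.toReal_pos (zero_lt_two.trans_le hp).ne' hp').ne'
    rw [← add_mul, hBB, ha, ← Real.rpow_mul hn0.le, hq, one_div, ENNReal.toReal_inv, neg_mul,
      inv_mul_cancel₀ hp0, Real.rpow_neg_one, mul_inv_cancel₀ hn0.ne']

/-- Only the monomials `z_j z_k^(m-1)` with `k` the single index off `B` are used. The coordinate
`k` has `p`-th power `1/2`, those in `B` have `1/(2n)`, and summing over `j` gives `n · n^(-1/p)`.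
-/
theorem lintegral_polySup_ge_of_lt_two {c₀ : ℝ} (hc₀ : 0 < c₀) {p : ℝ≥0∞} (hp' : p ≠ ∞)
    (hp1 : 1 < p.toReal) {n m : ℕ} (hn : 2 ≤ n) (hm : 1 ≤ m) {Ω : Type u} [MeasurableSpace Ω]
    {μ : Measure Ω} {γ : MultiIndex n m → Ω → ℂ} (hγ : ∀ α, Measurable (γ α))
    (hK : ∀ T : Finset (MultiIndex n m),
      ENNReal.ofReal (c₀ * √T.card) ≤ ∫⁻ ω, ENNReal.ofReal ‖∑ i ∈ T, γ i ω‖ ∂μ) :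
    ENNReal.ofReal (((2 : ℝ) ^ (-p.toReal⁻¹)) ^ m * (c₀ / 2 * √(1 / (m - 1).factorial)) *
      (n : ℝ) ^ (1 - p.toReal⁻¹)) ≤
      ∫⁻ ω, ENNReal.ofReal (polySup p fun α => γ α ω) ∂μ := by
  have : Fact (1 ≤ p) := ⟨by
    rw [← ENNReal.ofReal_toReal hp', ← ENNReal.ofReal_one]
    exact ENNReal.ofReal_le_ofReal hp1.le⟩
  obtain ⟨B, -, hB⟩ := Finset.exists_subset_card_eq (s := (Finset.univ : Finset (Fin n)))
    (n := n - 1) (by simp)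
  have hBc : Bᶜ.card = 1 := by
    rw [Finset.card_compl, Fintype.card_fin, hB]
    omega
  have hn0 : (0 : ℝ) < n := by exact_mod_cast (by omega : 0 < n)
  have hBcard : (n : ℝ) / 2 ≤ B.card := by
    rw [div_le_iff₀ (by norm_num), hB]
    exact_mod_cast (by omega : n ≤ (n - 1) * 2)
  have hBn : (B.card : ℝ) ≤ n := by
    rw [hB]
    exact_mod_cast Nat.sub_le n 1
  set q : ℝ := p.toReal with hq
  have hq0 : q ≠ 0 := by linarith
  set a : ℝ := (2 : ℝ) ^ (-q⁻¹) with ha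
  set b : ℝ := (2 * n : ℝ) ^ (-q⁻¹) with hb
  have ha0 : 0 < a := by positivity
  have hb0 : 0 < b := by positivity
  refine le_trans (ENNReal.ofReal_le_ofReal ?_) (lintegral_polySup_ge hm hc₀.le hγ hK
    (B := B) ha0.le hb0.le (norm_le_one_of_norm_apply_eq (fun h => absurd h hp') fun _ => ?_))
  · have h1 : a ^ m = a ^ (m - 1) * a := by rw [← pow_succ, Nat.sub_add_cancel hm]
    have h2 : b = a * (n : ℝ) ^ (-q⁻¹) := Real.mul_rpow two_pos.le hn0.le
    have h3 : (n : ℝ) ^ (1 - q⁻¹) = n * (n : ℝ) ^ (-q⁻¹) := by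
      rw [sub_eq_add_neg, Real.rpow_add hn0, Real.rpow_one]
    rw [hBc, Nat.cast_one, one_pow]
    calc a ^ m * (c₀ / 2 * √(1 / (m - 1).factorial)) * (n : ℝ) ^ (1 - q⁻¹)
        = a ^ (m - 1) * b * (n / 2 * (c₀ * √(1 / (m - 1).factorial))) := by
          rw [h1, h2, h3]
          ring
      _ ≤ _ := by gcongr
  · rw [← hq, hBc, ha, hb, ← Real.rpow_mul (by positivity), ← Real.rpow_mul (by positivity),
      neg_mul, inv_mul_cancel₀ hq0, Real.rpow_neg_one, Real.rpow_neg_one, Nat.cast_one, one_mul]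
    have h : (B.card : ℝ) * (2 * n : ℝ)⁻¹ ≤ 2⁻¹ := by
      rw [mul_inv_le_iff₀ (by positivity)]
      linarith
    linarith

/-- For `n = 1` both choices of `B` would be empty; evaluation at `z = 1` suffices. -/
theorem lintegral_polySup_ge_of_eq_one {c₀ : ℝ} (hc₀ : 0 < c₀) {p : ℝ≥0∞} (hp : 1 ≤ p) {m : ℕ}
    {Ω : Type u} [MeasurableSpace Ω] {μ : Measure Ω} {γ : MultiIndex 1 m → Ω → ℂ}
    (hK : ∀ T : Finset (MultiIndex 1 m),
      ENNReal.ofReal (c₀ * √T.card) ≤ ∫⁻ ω, ENNReal.ofReal ‖∑ i ∈ T, γ i ω‖ ∂μ) :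
    ENNReal.ofReal c₀ ≤ ∫⁻ ω, ENNReal.ofReal (polySup p fun α => γ α ω) ∂μ := by
  have : Fact (1 ≤ p) := ⟨hp⟩
  let α : MultiIndex 1 m := ⟨fun _ => m, by simp [Finset.mem_piAntidiag]⟩
  have hcard : (1 : ℝ) ≤ (Finset.univ : Finset (MultiIndex 1 m)).card := by
    exact_mod_cast Finset.card_pos.2 ⟨α, Finset.mem_univ _⟩
  calc ENNReal.ofReal c₀
      ≤ ENNReal.ofReal (c₀ * √(Finset.univ : Finset (MultiIndex 1 m)).card) :=
        ENNReal.ofReal_le_ofReal (le_mul_of_one_le_right hc₀.le (Real.one_le_sqrt.2 hcard))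
    _ ≤ _ := hK Finset.univ
    _ ≤ _ := by
        refine lintegral_mono fun ω => ENNReal.ofReal_le_ofReal ?_
        let z : PiLp p (fun _ : Fin 1 => ℂ) := WithLp.toLp p fun _ => 1
        have hz : ‖z‖ ≤ 1 := norm_le_one_of_norm_apply_eq (B := ∅) (a := 1) (b := 1)
          (fun _ => ⟨le_rfl, le_rfl⟩) (fun _ => by simp) z (fun i => by simp [z])
        have h := norm_homEval_le_polySup (fun α => γ α ω) hz
        have h1 : homEval (fun α => γ α ω) z.ofLp = ∑ α, γ α ω := by simp [homEval, z]
        rwa [h1] at h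

theorem le_expOrliczNorm_polySup {p : ℝ≥0∞} (hp : 1 < p) {m : ℕ} (hm : 1 ≤ m) :
    ∃ c : ℝ, 0 < c ∧ ∀ n : ℕ, 1 ≤ n →
      ∀ (Ω : Type u) [MeasurableSpace Ω] (μ : Measure Ω) [IsProbabilityMeasure μ]
        (γ : MultiIndex n m → Ω → ℂ), (∀ α, Measurable (γ α)) → iIndepFun γ μ →
        (∀ α, IsStdSubgaussian (γ α) μ) →
        ENNReal.ofReal
            (c * (n : ℝ) ^ (1 / rExp p + (m : ℝ) * max (1 / 2 - (1 / p).toReal) 0)) ≤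
          expOrliczNorm (rExp p) (fun ω => polySup p (fun α => γ α ω)) μ := by
  obtain ⟨c₀, hc₀, hK⟩ := exists_le_lintegral_norm_sum.{u}
  obtain ⟨c₁, hc₁, h₁⟩ : ∃ c₁ : ℝ, 0 < c₁ ∧ ∀ n : ℕ, 2 ≤ n →
      ∀ (Ω : Type u) [MeasurableSpace Ω] (μ : Measure Ω) [IsProbabilityMeasure μ]
        (γ : MultiIndex n m → Ω → ℂ), (∀ α, Measurable (γ α)) → iIndepFun γ μ →
        (∀ α, IsStdSubgaussian (γ α) μ) →
        ENNReal.ofReal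
            (c₁ * (n : ℝ) ^ (1 / rExp p + (m : ℝ) * max (1 / 2 - (1 / p).toReal) 0)) ≤
          ∫⁻ ω, ENNReal.ofReal (polySup p fun α => γ α ω) ∂μ := by
    rcases (two_le_rExp hp).eq_or_lt with hr | hr
    · have hp2 := two_le_of_rExp_eq_two hp hr.symm
      refine ⟨c₀ / 3 * √((1 / 2) ^ (m - 1) / (m - 1).factorial), by positivity,
        fun n hn Ω _ μ _ γ hγ hind hstd => ?_⟩
      rw [← hr, max_half_sub_eq_of_two_le hp2]
      exact lintegral_polySup_ge_of_two_le hc₀ hp2 hn hm hγ (hK Ω μ _ γ hγ hind hstd)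
    · obtain ⟨hp', hq1, hq2, hrq⟩ := of_two_lt_rExp hp hr
      refine ⟨((2 : ℝ) ^ (-p.toReal⁻¹)) ^ m * (c₀ / 2 * √(1 / (m - 1).factorial)), by positivity,
        fun n hn Ω _ μ _ γ hγ hind hstd => ?_⟩
      have hexp : 1 / rExp p + (m : ℝ) * max (1 / 2 - (1 / p).toReal) 0 = 1 - p.toReal⁻¹ := by
        rw [max_half_sub_eq_zero hq1 hq2, hrq, mul_zero, add_zero, one_div_div]
        have : p.toReal ≠ 0 := by linarith
        field_simp
      rw [hexp]
      exact lintegral_polySup_ge_of_lt_two hc₀ hp' hq1 hn hm hγ (hK Ω μ _ γ hγ hind hstd)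
  refine ⟨min c₀ c₁ / 2, by positivity, fun n hn Ω _ μ _ γ hγ hind hstd => ?_⟩
  rw [div_mul_eq_mul_div]
  refine le_expOrliczNorm (one_le_two.trans (two_le_rExp hp)) ?_
  rcases hn.eq_or_lt with rfl | hn
  · refine (ENNReal.ofReal_le_ofReal ?_).trans
      (lintegral_polySup_ge_of_eq_one hc₀ hp.le (hK Ω μ _ γ hγ hind hstd))
    simp
  · refine (ENNReal.ofReal_le_ofReal ?_).trans (h₁ n hn Ω μ γ hγ hind hstd)
    gcongr
    exact min_le_right _ _

/-! ### Transfer to the norms and laws of the main theorem -/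

theorem ae_norm_le_of_eLpNorm_top_le {Ω : Type*} [MeasurableSpace Ω] {μ : Measure Ω} {f : Ω → ℂ}
    {M : ℝ≥0} (h : eLpNorm f ∞ μ ≤ M) : ∀ᵐ ω ∂μ, ‖f ω‖ ≤ M := by
  rw [eLpNorm_exponent_top] at h
  filter_upwards [ae_le_eLpNormEssSup (f := f) (μ := μ)] with ω hω
  have h1 : ‖f ω‖ₑ ≤ (M : ℝ≥0∞) := hω.trans h
  rw [enorm_eq_nnnorm, ENNReal.coe_le_coe] at h1
  exact_mod_cast h1

theorem isStdSubgaussian_of_map {Ω : Type u} [MeasurableSpace Ω] {μ : Measure Ω} {f : Ω → ℂ}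
    (hf : Measurable f) (h : μ.map f = rademacherLaw ∨ μ.map f = steinhausLaw ∨
      μ.map f = realNormalLaw ∨ μ.map f = complexNormalLaw) : IsStdSubgaussian f μ := by
  rw [← isStdSubgaussian_map_iff hf]
  rcases h with h | h | h | h <;> rw [h]
  exacts [isStdSubgaussian_rademacherLaw, isStdSubgaussian_steinhausLaw,
    isStdSubgaussian_realNormalLaw, isStdSubgaussian_complexNormalLaw]

theorem ae_norm_le_one_of_map {Ω : Type*} [MeasurableSpace Ω] {μ : Measure Ω} {f : Ω → ℂ}
    (hf : Measurable f) (h : μ.map f = rademacherLaw ∨ μ.map f = steinhausLaw) :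
    ∀ᵐ ω ∂μ, ‖f ω‖ ≤ 1 := by
  have h1 : ∀ᵐ x ∂(μ.map f), ‖x‖ = 1 := by
    rcases h with h | h <;> rw [h]
    exacts [norm_eq_one_rademacherLaw, norm_eq_one_steinhausLaw]
  filter_upwards [ae_of_ae_map hf.aemeasurable h1] with ω hω using hω.le

theorem mul_rpow_mul_one_add_log_eq {n m : ℕ} (hn : 1 ≤ n) (hm : 1 ≤ m) (C r e : ℝ) :
    C * ((n : ℝ) * (1 + Real.log m)) ^ (1 / r) * (n : ℝ) ^ e =
      C * (1 + Real.log m) ^ (1 / r) * (n : ℝ) ^ (1 / r + e) := by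
  have hn0 : (0 : ℝ) < n := by exact_mod_cast hn
  have hlog : 0 ≤ Real.log m := Real.log_nonneg (by exact_mod_cast hm)
  rw [Real.mul_rpow hn0.le (by positivity), Real.rpow_add hn0]
  ring

end

theorem mainTheorem8 :
    -- upper estimate, case `r(p) = 2`: the constant depends only on `s`
    (∀ s : ℝ, ∃ C : ℝ, 0 < C ∧
      ∀ p : ℝ≥0∞, 1 < p → rExp p = 2 →
      ∀ n m : ℕ, 1 ≤ n → 1 ≤ m →
      ∀ (Ω : Type u) [MeasurableSpace Ω] (μ : Measure Ω) [IsProbabilityMeasure μ]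
        (γ : MultiIndex n m → Ω → ℂ),
        (∀ α, Measurable (γ α)) → iIndepFun γ μ →
        (∀ α, IsSubgaussian (γ α) μ) → (∀ α, sg (γ α) μ ≤ s) →
        expOrliczNorm (rExp p) (fun ω => polySup p (fun α => γ α ω)) μ ≤
          ENNReal.ofReal (C * ((n : ℝ) * (1 + Real.log m)) ^ (1 / rExp p) *
            (n : ℝ) ^ ((m : ℝ) * max (1 / 2 - (1 / p).toReal) 0))) ∧
    -- upper estimate, case `r(p) = r > 2`: the constant depends only on `r`, `s` and `M`
    (∀ r : ℝ, 2 < r → ∀ (s : ℝ) (M : ℝ≥0), ∃ C : ℝ, 0 < C ∧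
      ∀ p : ℝ≥0∞, 1 < p → rExp p = r →
      ∀ n m : ℕ, 1 ≤ n → 1 ≤ m →
      ∀ (Ω : Type u) [MeasurableSpace Ω] (μ : Measure Ω) [IsProbabilityMeasure μ]
        (γ : MultiIndex n m → Ω → ℂ),
        (∀ α, Measurable (γ α)) → iIndepFun γ μ →
        (∀ α, IsSubgaussian (γ α) μ) → (∀ α, sg (γ α) μ ≤ s) →
        (∀ α, eLpNorm (γ α) ∞ μ ≤ M) →
        expOrliczNorm (rExp p) (fun ω => polySup p (fun α => γ α ω)) μ ≤
          ENNReal.ofReal (C * ((n : ℝ) * (1 + Real.log m)) ^ (1 / rExp p) *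
            (n : ℝ) ^ ((m : ℝ) * max (1 / 2 - (1 / p).toReal) 0))) ∧
    -- two-sided estimate for fixed `m`: the constants depend only on `m` and `p`
    (∀ p : ℝ≥0∞, 1 < p → ∀ m : ℕ, 1 ≤ m → ∃ c C : ℝ, 0 < c ∧ 0 < C ∧
      ∀ n : ℕ, 1 ≤ n →
      ∀ (Ω : Type u) [MeasurableSpace Ω] (μ : Measure Ω) [IsProbabilityMeasure μ]
        (γ : MultiIndex n m → Ω → ℂ),
        (∀ α, Measurable (γ α)) → iIndepFun γ μ →
        (∀ α, μ.map (γ α) = rademacherLaw ∨ μ.map (γ α) = steinhausLaw ∨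
          (rExp p = 2 ∧ (μ.map (γ α) = realNormalLaw ∨ μ.map (γ α) = complexNormalLaw))) →
        ENNReal.ofReal
            (c * (n : ℝ) ^ (1 / rExp p + (m : ℝ) * max (1 / 2 - (1 / p).toReal) 0)) ≤
          expOrliczNorm (rExp p) (fun ω => polySup p (fun α => γ α ω)) μ ∧
        expOrliczNorm (rExp p) (fun ω => polySup p (fun α => γ α ω)) μ ≤
          ENNReal.ofReal
            (C * (n : ℝ) ^ (1 / rExp p + (m : ℝ) * max (1 / 2 - (1 / p).toReal) 0))) := by
  refine ⟨fun s => ?_, fun r hr s M => ?_, fun p hp m hm => ?_⟩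
  -- `|s| + 1` is positive for every real `s` and strictly exceeds `s`, as the passage from `sg` to
  -- a bound requires.
  · obtain ⟨C, hC, h⟩ := expOrliczNorm_polySup_le_of_two_le.{u} (s := |s| + 1) (by positivity)
    refine ⟨C, hC, fun p hp hr n m hn hm Ω _ μ _ γ hγ hind hsub hs => ?_⟩
    have hp2 := two_le_of_rExp_eq_two hp hr
    rw [hr, max_half_sub_eq_of_two_le hp2]
    exact h p hp2 n m hn hm Ω μ γ hγ hind fun α =>
      (hsub α).hasSubgaussianBound (hs α) (by linarith [le_abs_self s])
  · obtain ⟨C, hC, h⟩ := expOrliczNorm_polySup_le_of_bounded.{u} (s := |s| + 1) (M := M + 1) hr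
      (by positivity) (by positivity)
    refine ⟨C, hC, fun p hp hpr n m hn hm Ω _ μ _ γ hγ hind hsub hs hM => ?_⟩
    obtain ⟨-, hq1, hq2, -⟩ := of_two_lt_rExp hp (hpr.symm ▸ hr)
    rw [hpr, max_half_sub_eq_zero hq1 hq2, mul_zero, Real.rpow_zero, mul_one]
    refine h p hp hpr n m hn hm Ω μ γ hγ hind (fun α =>
      (hsub α).hasSubgaussianBound (hs α) (by linarith [le_abs_self s])) fun α => ?_
    filter_upwards [ae_norm_le_of_eLpNorm_top_le (hM α)] with ω hω
    linarith
  · obtain ⟨c, hc, hlow⟩ := le_expOrliczNorm_polySup.{u} hp hm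
    have hlog : 0 ≤ Real.log m := Real.log_nonneg (by exact_mod_cast hm)
    rcases (two_le_rExp hp).eq_or_lt with hr | hr
    · obtain ⟨C, hC, h⟩ := expOrliczNorm_polySup_le_of_two_le.{u} (s := 1) one_pos
      -- With `m` fixed, the logarithmic factor goes into the constant.
      refine ⟨c, C * (1 + Real.log m) ^ (1 / rExp p), hc, by positivity,
        fun n hn Ω _ μ _ γ hγ hind hlaw => ?_⟩
      have hstd : ∀ α, IsStdSubgaussian (γ α) μ := fun α =>
        isStdSubgaussian_of_map (hγ α) ((hlaw α).imp_right (Or.imp_right And.right))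
      refine ⟨hlow n hn Ω μ γ hγ hind hstd, ?_⟩
      have hp2 := two_le_of_rExp_eq_two hp hr.symm
      rw [← mul_rpow_mul_one_add_log_eq hn hm, ← hr, max_half_sub_eq_of_two_le hp2]
      exact h p hp2 n m hn hm Ω μ γ hγ hind fun α => (hstd α).bound
    · obtain ⟨C, hC, h⟩ := expOrliczNorm_polySup_le_of_bounded.{u} hr one_pos one_pos
      refine ⟨c, C * (1 + Real.log m) ^ (1 / rExp p), hc, by positivity,
        fun n hn Ω _ μ _ γ hγ hind hlaw => ?_⟩
      have hstd : ∀ α, IsStdSubgaussian (γ α) μ := fun α =>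
        isStdSubgaussian_of_map (hγ α) ((hlaw α).imp_right (Or.imp_right And.right))
      refine ⟨hlow n hn Ω μ γ hγ hind hstd, ?_⟩
      obtain ⟨-, hq1, hq2, -⟩ := of_two_lt_rExp hp hr
      rw [← mul_rpow_mul_one_add_log_eq hn hm, max_half_sub_eq_zero hq1 hq2, mul_zero,
        Real.rpow_zero, mul_one]
      refine h p hp rfl n m hn hm Ω μ γ hγ hind (fun α => (hstd α).bound) fun α => ?_
      refine ae_norm_le_one_of_map (hγ α) ((hlaw α).imp_right fun h => ?_)
      rcases h with h | h
      · exact h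
      · exact absurd h.1 hr.ne'
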